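/- Let $F$ be a formally real field that is not pythagorean, i.e. $-1$ is not a sum of squares in $F$ and some sum of squares in $F$ is not a square. Quadratic forms are finite-dimensional and nondegenerate. A form is called torsion if its class in the Witt group is torsion. A supreme torsion form over a field is an anisotropic torsion form $\varphi$ such that every anisotropic torsion form over that field is similar to a subform of $\varphi$. An $n$-fold Pfister form is a form isometric to $\langle 1,-a_1\rangle\otimes\cdots\otimes\langle 1,-a_n\rangle$ with all $a_i\neq 0$, and $\langle\langle t\rangle\rangle=\langle 1,-t\rangle$. Forms over $F$ are regarded as forms over the Laurent series field $F((t))$ by scalar extension. (1) Let $n\in\mathbb N$ and let $\varphi$ be an $n$-fold Pfister form over $F$ that is a supreme torsion form over $F$. Then $\varphi\otimes\langle\langle t\rangle\rangle$ is a supreme torsion form over $F((t))$. (2) Let $\psi$ be a form over $F((t))$ with first and second residue class forms $\psi_1$ and $-\psi_2$ over $F$; that is, $\psi\cong\langle u_1,\dots,u_r\rangle\perp t\langle v_1,\dots,v_s\rangle$ for some units $u_i,v_j$ of $F[[t]]$ with $\psi_1\cong\langle u_1(0),\dots,u_r(0)\rangle$ and $-\psi_2\cong\langle v_1(0),\dots,v_s(0)\rangle$.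 Then $\psi\cong\psi_1\perp -t\psi_2$ over $F((t))$, and if $\psi$ is a supreme torsion form over $F((t))$, then $\psi_1\cong\psi_2$, and this form is a supreme torsion form over $F$. -/

import Mathlib

universe u

namespace QForm

open scoped TensorProduct

section General

variable {F : Type u} [Field F]

/-- A quadratic form in the sense used here: finite-dimensional and nondegenerate. -/
def IsForm {V : Type u} [AddCommGroup V] [Module F V] (Q : QuadraticForm F V) : Prop :=
  FiniteDimensional F V ∧ Q.Nondegenerate

/-- The diagonal form `⟨a₁, …, aₙ⟩` on `Fⁿ`. -/
noncomputable def diag {n : ℕ} (a : Fin n → F) : QuadraticForm F (Fin n → F) :=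
  QuadraticMap.weightedSumSquares F a

/-- The orthogonal sum `Q ⊥ … ⊥ Q` of `n` copies of `Q`. -/
noncomputable def copies {V : Type u} [AddCommGroup V] [Module F V] (n : ℕ)
    (Q : QuadraticForm F V) : QuadraticForm F (Fin n → V) :=
  QuadraticMap.pi fun _ => Q

/-- The hyperbolic plane `⟨1, -1⟩` (the characteristic is not two here). -/
noncomputable def hyperbolicPlane (F : Type u) [Field F] : QuadraticForm F (Fin 2 → F) :=
  diag ![1, -1]

/-- Two forms have the same class in the Witt group iff they become isometric after adding
hyperbolic planes. -/
def WittEquivalent {V W : Type u} [AddCommGroup V] [Module F V] [AddCommGroup W] [Module F W]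
    (Q : QuadraticForm F V) (P : QuadraticForm F W) : Prop :=
  ∃ r s : ℕ, (Q.prod (copies r (hyperbolicPlane F))).Equivalent
    (P.prod (copies s (hyperbolicPlane F)))

/-- The Witt class of `Q` is torsion: for some `n > 0`, the class of `n × Q` (that is, `n` times
the class of `Q`) is the class of the zero-dimensional form. -/
def IsTorsion {V : Type u} [AddCommGroup V] [Module F V] (Q : QuadraticForm F V) : Prop :=
  ∃ n : ℕ, 0 < n ∧ WittEquivalent (copies n Q) (0 : QuadraticForm F PUnit.{u + 1})

/-- `P` is (isometric to) a subform of `Q`: `Q ≅ P ⊥ R` for some form `R`. -/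
def IsSubform {V W : Type u} [AddCommGroup V] [Module F V] [AddCommGroup W] [Module F W]
    (P : QuadraticForm F W) (Q : QuadraticForm F V) : Prop :=
  ∃ (U : Type u) (_ : AddCommGroup U) (_ : Module F U) (R : QuadraticForm F U),
    IsForm R ∧ Q.Equivalent (P.prod R)

/-- A supreme torsion form: an anisotropic torsion form such that every anisotropic torsion form
is similar to a subform of it. -/
structure IsSupremeTorsionForm {V : Type u} [AddCommGroup V] [Module F V]
    (Q : QuadraticForm F V) : Prop where
  isForm : IsForm Q
  anisotropic : Q.Anisotropic
  torsion : IsTorsion Q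
  supreme : ∀ (W : Type u) [AddCommGroup W] [Module F W] (P : QuadraticForm F W),
    IsForm P → P.Anisotropic → IsTorsion P → ∃ a : F, a ≠ 0 ∧ IsSubform (a • P) Q

end General

section CharZero

/-- The tensor product `P ⊗ Q` of two quadratic forms over a field of characteristic zero. -/
noncomputable def tensor {F : Type u} [Field F] [CharZero F] {V W : Type u}
    [AddCommGroup V] [Module F V] [AddCommGroup W] [Module F W]
    (P : QuadraticForm F V) (Q : QuadraticForm F W) : QuadraticForm F (V ⊗[F] W) :=
  letI : Invertible (2 : F) := invertibleOfNonzero two_ne_zero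
  QuadraticForm.tmul P Q

/-- The scalar extension `Q_K` of a quadratic form over a field of characteristic zero. -/
noncomputable def extend {F : Type u} [Field F] [CharZero F] (K : Type u) [Field K] [Algebra F K]
    {V : Type u} [AddCommGroup V] [Module F V] (Q : QuadraticForm F V) :
    QuadraticForm K (K ⊗[F] V) :=
  letI : Invertible (2 : F) := invertibleOfNonzero two_ne_zero
  QuadraticForm.baseChange K Q

/-- The one-fold Pfister form `⟨⟨a⟩⟩ = ⟨1, -a⟩`. -/
noncomputable def pfister {F : Type u} [Field F] (a : F) : QuadraticForm F (Fin 2 → F) :=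
  diag ![1, -a]

/-- `IsPfister n Q`: the form `Q` is isometric to an `n`-fold Pfister form
`⟨⟨a₁, …, aₙ⟩⟩ = ⟨1, -a₁⟩ ⊗ ⋯ ⊗ ⟨1, -aₙ⟩` with all `aᵢ ≠ 0` (the empty product being `⟨1⟩`). -/
inductive IsPfister {F : Type u} [Field F] [CharZero F] :
    ℕ → ∀ {V : Type u} [AddCommGroup V] [Module F V], QuadraticForm F V → Prop
  | zero {V : Type u} [AddCommGroup V] [Module F V] (Q : QuadraticForm F V)
      (h : Q.Equivalent (diag ![(1 : F)])) : IsPfister 0 Q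
  | succ {n : ℕ} {V W : Type u} [AddCommGroup V] [Module F V] [AddCommGroup W] [Module F W]
      (Q : QuadraticForm F V) (P : QuadraticForm F W) (a : F) (ha : a ≠ 0)
      (hP : IsPfister n P) (h : Q.Equivalent (tensor (pfister a) P)) : IsPfister (n + 1) Q

end CharZero

section Laurent

variable (F : Type u) [Field F]

/-- `F((t))` as an `F`-algebra through the constant series. Mathlib also has the instance
`HahnSeries.powerSeriesAlgebra`, with the same structure map; the one chosen here is compatible with
the coefficientwise scalar multiplication. -/
noncomputable instance laurentAlgebra : Algebra F (LaurentSeries F) :=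
  HahnSeries.instAlgebra

instance [CharZero F] : CharZero (LaurentSeries F) :=
  charZero_of_injective_algebraMap (algebraMap F (LaurentSeries F)).injective

/-- The uniformizer `t` of `F((t))`. -/
noncomputable def t : LaurentSeries F := HahnSeries.single 1 1

variable {F}

/-- `q₁` and `q₂` are a first and a second residue class form (with respect to the uniformizer `t`)
of the form `ψ` over `F((t))`: there are units `uᵢ, vⱼ` of `F[[t]]` such that
`ψ ≅ ⟨u₁, …, u_r⟩ ⊥ t⟨v₁, …, v_s⟩`, and `q₁`, `q₂` are the diagonal forms over the residue field
`F` whose entries are the residues (constant coefficients) of the `uᵢ`, resp. of the `vⱼ`. -/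
def HasResidueForms {V V₁ V₂ : Type u} [AddCommGroup V] [Module (LaurentSeries F) V]
    [AddCommGroup V₁] [Module F V₁] [AddCommGroup V₂] [Module F V₂]
    (ψ : QuadraticForm (LaurentSeries F) V)
    (q₁ : QuadraticForm F V₁) (q₂ : QuadraticForm F V₂) : Prop :=
  ∃ (r s : ℕ) (u : Fin r → (PowerSeries F)ˣ) (v : Fin s → (PowerSeries F)ˣ),
    ψ.Equivalent
      ((diag fun i => HahnSeries.ofPowerSeries ℤ F (u i : PowerSeries F)).prod
        (t F • diag fun j => HahnSeries.ofPowerSeries ℤ F (v j : PowerSeries F))) ∧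
    q₁.Equivalent (diag fun i => PowerSeries.constantCoeff (u i : PowerSeries F)) ∧
    q₂.Equivalent (diag fun j => PowerSeries.constantCoeff (v j : PowerSeries F))

end Laurent

end QForm

/-!
Write `K = F((t))`. The two parts both rest on Springer's description of forms over `K`, which is
obtained here by looking at leading coefficients. Up to squares, a nonzero element of `K` is `a` or
`t a` with a constant `a`, because power series with constant coefficient `1` are squares; hence
every form over `K` is isometric to `Q₁ ⊥ t Q₂` with forms `Q₁`, `Q₂` over `F` (`laurentSum`,
`exists_equivalent_laurentSum`). If `Q₁` and `Q₂` are anisotropic, the leading terms of `Q₁(y)` and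
`t Q₂(z)` have different parity and cannot cancel (`coeff_eq_zero_of_anisotropic`). So `Q₁ ⊥ t Q₂`
is anisotropic, a vector with integral value is integral, and an isometry
`P₁ ⊥ t P₂ → Q₁ ⊥ t Q₂` reduces modulo `t` to isometries `P₁ → Q₁` and `P₂ → Q₂`
(`nonempty_isometry_of_laurentSum`).

Torsion is treated through metabolic forms, those with a totally isotropic subspace of half the
dimension. Metabolic forms cancel from orthogonal sums (`IsMetabolic.of_prod`), so a form is torsion
if and only if one of its multiples is metabolic (`isTorsion_iff`). Splitting off hyperbolic planes
until the residue forms are anisotropic shows that `Q₁` and `Q₂` are metabolic if `Q₁ ⊥ t Q₂` is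
(`isMetabolic_of_laurentSum`), and therefore that they are torsion if `Q₁ ⊥ t Q₂` is.

For the first part, let `φ` be a Pfister form which is a supreme torsion form. For every `a ≠ 0` the
torsion form `φ ⊥ -aφ` is too large to be anisotropic, so that `a` is a quotient of two values of
`φ`. Pfister forms are round, whence `aφ ≅ φ` (`equivalent_smul_of_isRound`). An anisotropic torsion
form over `K` is `Q₁ ⊥ t Q₂` with `Q₁` and `Q₂` anisotropic and torsion; both are similar to
subforms of `φ`, hence are subforms of `φ ≅ -φ`, and `Q₁ ⊥ t Q₂` is a subform of `φ ⊥ -tφ`.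

For the second part, let `Q₁ ⊥ t Q₂` be a supreme torsion form over `K` and let `ρ` be an
anisotropic torsion form over `F`. Then `ρ ⊥ -tρ` is similar to a subform of `Q₁ ⊥ t Q₂`, and
passing to residue forms gives `a ≠ 0` in `F` such that `aρ` is a subform of `Q₁` and `-aρ` one of
`Q₂`. Thus `Q₁` is supreme, and taking `ρ = Q₁` and `ρ = Q₂` and comparing dimensions gives
`Q₁ ≅ aQ₁ ≅ -Q₂`.
-/

namespace QForm

open QuadraticMap Module

/-! ### Isometries, nondegeneracy, and splitting off subforms -/

section Forms

variable {K : Type u} [Field K] {V W V' W' : Type u}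
  [AddCommGroup V] [Module K V] [AddCommGroup W] [Module K W]
  [AddCommGroup V'] [Module K V'] [AddCommGroup W'] [Module K W']

theorem anisotropic_of_isometry {P : QuadraticForm K W} {Q : QuadraticForm K V}
    (hQ : Q.Anisotropic) (f : P →qᵢ Q) (hf : Function.Injective f) : P.Anisotropic := by
  intro x hx
  have : f x = 0 := hQ _ (by rw [f.map_app, hx])
  exact hf (by rw [this, map_zero])

theorem injective_of_anisotropic {P : QuadraticForm K W} {Q : QuadraticForm K V}
    (hP : P.Anisotropic) (f : P →qᵢ Q) : Function.Injective f := by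
  refine (injective_iff_map_eq_zero f).2 fun x hx => hP x ?_
  rw [← f.map_app, hx, QuadraticMap.map_zero]

theorem anisotropic_of_equivalent {P : QuadraticForm K W} {Q : QuadraticForm K V}
    (h : P.Equivalent Q) (hQ : Q.Anisotropic) : P.Anisotropic := by
  obtain ⟨e⟩ := h
  exact anisotropic_of_isometry hQ e.toIsometry e.injective

theorem anisotropic_smul {Q : QuadraticForm K V} (hQ : Q.Anisotropic) {a : K} (ha : a ≠ 0) :
    (a • Q).Anisotropic := by
  intro x hx
  exact hQ x (by simpa [ha] using hx)

theorem equivalent_smul {P : QuadraticForm K W} {Q : QuadraticForm K V} (a : K)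
    (h : P.Equivalent Q) : (a • P).Equivalent (a • Q) := by
  obtain ⟨e⟩ := h
  exact ⟨⟨e.toLinearEquiv, fun x => by simp⟩⟩

theorem equivalent_prodComm (P : QuadraticForm K W) (Q : QuadraticForm K V) :
    (P.prod Q).Equivalent (Q.prod P) :=
  ⟨IsometryEquiv.prodComm _ _⟩

theorem equivalent_prodAssoc (P : QuadraticForm K W) (Q : QuadraticForm K V)
    (R : QuadraticForm K V') : ((P.prod Q).prod R).Equivalent (P.prod (Q.prod R)) :=
  ⟨⟨LinearEquiv.prodAssoc K W V V', fun x => by simp [add_assoc]⟩⟩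

theorem equivalent_prod_of_subsingleton_right [Subsingleton V] (P : QuadraticForm K W)
    (Q : QuadraticForm K V) : (P.prod Q).Equivalent P :=
  have : Unique V := uniqueOfSubsingleton 0
  ⟨⟨LinearEquiv.prodUnique, fun x => by simp [Subsingleton.elim x.2 0]⟩⟩

theorem equivalent_prod_of_subsingleton_left [Subsingleton V] (P : QuadraticForm K W)
    (Q : QuadraticForm K V) : (Q.prod P).Equivalent P :=
  (equivalent_prodComm _ _).trans (equivalent_prod_of_subsingleton_right _ _)

theorem polar_isometry {P : QuadraticForm K W} {Q : QuadraticForm K V} (f : P →qᵢ Q) (x y : W) :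
    polar Q (f x) (f y) = polar P x y := by
  simp only [polar, ← map_add, f.map_app]

theorem polarBilin_isRefl (Q : QuadraticForm K V) : LinearMap.IsRefl (polarBilin Q) := by
  intro x y h
  rw [polarBilin_apply_apply] at *
  rwa [polar_comm]

variable [NeZero (2 : K)]

theorem nondegenerate_iff_polar {Q : QuadraticForm K V} :
    Q.Nondegenerate ↔ ∀ x, (∀ y, polar Q x y = 0) → x = 0 := by
  let : Invertible (2 : K) := invertibleOfNonzero two_ne_zero
  rw [← nondegenerate_polar_iff,
    LinearMap.IsRefl.nondegenerate_iff_separatingLeft (polarBilin_isRefl Q)]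
  rfl

theorem nondegenerate_of_anisotropic {Q : QuadraticForm K V} (hQ : Q.Anisotropic) :
    Q.Nondegenerate := by
  refine nondegenerate_iff_polar.2 fun x hx => hQ x ?_
  have := hx x
  rw [polar_self, two_nsmul, ← two_mul] at this
  exact (mul_eq_zero.1 this).resolve_left two_ne_zero

theorem nondegenerate_of_equivalent {P : QuadraticForm K W} {Q : QuadraticForm K V}
    (h : P.Equivalent Q) (hQ : Q.Nondegenerate) : P.Nondegenerate := by
  obtain ⟨e⟩ := h
  rw [nondegenerate_iff_polar] at *
  intro x hx
  have := hQ (e x) fun y => by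
    obtain ⟨y, rfl⟩ := e.surjective y
    exact (polar_isometry e.toIsometry x y).trans (hx y)
  exact e.injective (this.trans (map_zero e).symm)

theorem nondegenerate_prod_iff {P : QuadraticForm K W} {Q : QuadraticForm K V} :
    (P.prod Q).Nondegenerate ↔ P.Nondegenerate ∧ Q.Nondegenerate := by
  simp only [nondegenerate_iff_polar]
  constructor
  · intro h
    refine ⟨fun x hx => ?_, fun x hx => ?_⟩
    · simpa using h (x, 0) fun y => by simp [hx]
    · simpa using h (0, x) fun y => by simp [hx]
  · rintro ⟨h₁, h₂⟩ ⟨x, y⟩ h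
    have hx := h₁ x fun z => by simpa using h (z, 0)
    have hy := h₂ y fun z => by simpa using h (0, z)
    rw [hx, hy]; rfl

theorem nondegenerate_smul {Q : QuadraticForm K V} (hQ : Q.Nondegenerate) {a : K} (ha : a ≠ 0) :
    (a • Q).Nondegenerate := by
  rw [nondegenerate_iff_polar] at *
  intro x hx
  refine hQ x fun y => ?_
  have := hx y
  rw [FunLike.coe_smul, polar_smul] at this
  simpa [ha] using this

theorem nondegenerate_copies {Q : QuadraticForm K V} (hQ : Q.Nondegenerate) (n : ℕ) :
    (copies n Q).Nondegenerate := by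
  rw [nondegenerate_iff_polar] at *
  intro x hx
  funext i
  refine hQ _ fun y => ?_
  have := hx (Pi.single i y)
  rw [copies, Ring.polar_pi, Finset.sum_eq_single i] at this
  · simpa using this
  · intro j _ hj
    simp [Pi.single_eq_of_ne hj]
  · simp

theorem nondegenerate_weightedSumSquares {ι : Type*} [Fintype ι] {w : ι → K}
    (hw : ∀ i, w i ≠ 0) : (weightedSumSquares K w).Nondegenerate := by
  let : Invertible (2 : K) := invertibleOfNonzero two_ne_zero
  rw [nondegenerate_iff_radical_eq_bot, QuadraticForm.radical_weightedSumSquares]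
  ext v
  simp [Pi.mem_spanSubset_iff, hw, funext_iff]

theorem exists_equivalent_weightedSumSquares [FiniteDimensional K V] {Q : QuadraticForm K V}
    (hQ : Q.Nondegenerate) : ∃ w : Fin (finrank K V) → Kˣ,
      Q.Equivalent (weightedSumSquares K fun i => (w i : K)) := by
  let : Invertible (2 : K) := invertibleOfNonzero two_ne_zero
  exact QuadraticForm.equivalent_weightedSumSquares_units_of_nondegenerate' Q
    (nondegenerate_associated_iff.2 hQ).1

theorem IsForm.of_equivalent {P : QuadraticForm K W} {Q : QuadraticForm K V}
    (h : P.Equivalent Q) (hQ : IsForm Q) : IsForm P := by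
  have := hQ.1
  exact ⟨(h.some.toLinearEquiv.symm.finiteDimensional), nondegenerate_of_equivalent h hQ.2⟩

theorem IsForm.of_anisotropic [FiniteDimensional K V] {Q : QuadraticForm K V}
    (hQ : Q.Anisotropic) : IsForm Q :=
  ⟨inferInstance, nondegenerate_of_anisotropic hQ⟩

theorem IsForm.prod {P : QuadraticForm K W} {Q : QuadraticForm K V} (hP : IsForm P)
    (hQ : IsForm Q) : IsForm (P.prod Q) := by
  have := hP.1
  have := hQ.1
  exact ⟨inferInstance, nondegenerate_prod_iff.2 ⟨hP.2, hQ.2⟩⟩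

theorem IsForm.smul {Q : QuadraticForm K V} (hQ : IsForm Q) {a : K} (ha : a ≠ 0) :
    IsForm (a • Q) :=
  ⟨hQ.1, nondegenerate_smul hQ.2 ha⟩

theorem IsForm.copies {Q : QuadraticForm K V} (hQ : IsForm Q) (n : ℕ) :
    IsForm (copies n Q) := by
  have := hQ.1
  exact ⟨inferInstance, nondegenerate_copies hQ.2 n⟩

theorem isForm_hyperbolicPlane : IsForm (hyperbolicPlane K) :=
  ⟨inferInstance, nondegenerate_weightedSumSquares (by simp [Fin.forall_fin_two])⟩

/-- A nondegenerate form that maps isometrically into `Q` splits off `Q`; the complement is the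
restriction of `Q` to the orthogonal complement of the image. -/
theorem equivalent_prod_restrict_of_isometry [FiniteDimensional K V] {P : QuadraticForm K W}
    {Q : QuadraticForm K V} (hP : P.Nondegenerate) (f : P →qᵢ Q) :
    ∃ U : Submodule K V, Q.Equivalent (P.prod (Q.restrict U)) := by
  have hB := polarBilin_isRefl Q
  have hf : Function.Injective f := by
    refine (injective_iff_map_eq_zero f).2 fun x hx => nondegenerate_iff_polar.1 hP x fun y => ?_
    rw [← polar_isometry f, hx, polar_zero_left]
  have hd : Disjoint f.toLinearMap.range
      (LinearMap.BilinForm.orthogonal (polarBilin Q) f.toLinearMap.range) := by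
    rw [Submodule.disjoint_def]
    rintro _ ⟨x, rfl⟩ h
    suffices x = 0 by simp [this]
    refine nondegenerate_iff_polar.1 hP x fun y => ?_
    have := h (f y) ⟨y, rfl⟩
    rw [polar_comm, ← polar_isometry f]
    exact this
  have hc := (LinearMap.BilinForm.isCompl_orthogonal_iff_disjoint hB).2 hd
  refine ⟨_, QuadraticMap.Equivalent.symm
    ⟨⟨((LinearEquiv.ofInjective f.toLinearMap hf).prodCongr (LinearEquiv.refl K _)).trans
      (Submodule.prodEquivOfIsCompl _ _ hc), ?_⟩⟩⟩
  rintro ⟨x, y, hy⟩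
  have h := hy (f x) ⟨x, rfl⟩
  rw [polarBilin_apply_apply] at h
  simp [QuadraticMap.map_add Q, h]

/-- An isotropic nondegenerate form splits off a hyperbolic plane. -/
theorem exists_equivalent_prod_hyperbolicPlane {Q : QuadraticForm K V} (hQ : IsForm Q)
    (hi : ¬ Q.Anisotropic) : ∃ (U : Submodule K V), IsForm (Q.restrict U) ∧
      Q.Equivalent ((Q.restrict U).prod (hyperbolicPlane K)) := by
  have := hQ.1
  obtain ⟨x, hx0, hx⟩ := (not_anisotropic_iff_exists Q).1 hi
  obtain ⟨y, hy⟩ : ∃ y, polar Q x y ≠ 0 := by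
    by_contra! h
    exact hx0 (nondegenerate_iff_polar.1 hQ.2 x h)
  obtain ⟨y, hy⟩ : ∃ y, polar Q x y = 1 :=
    ⟨(polar Q x y)⁻¹ • y, by rw [polar_smul_right, smul_eq_mul, inv_mul_cancel₀ hy]⟩
  -- `x` and `z` form a hyperbolic pair
  obtain ⟨z, hz, hxz⟩ : ∃ z, Q z = 0 ∧ polar Q x z = 1 := by
    -- subtracting a multiple of `x` from `y` makes `y` isotropic without changing `polar Q x y`
    refine ⟨y - Q y • x, ?_, ?_⟩
    · rw [sub_eq_add_neg, QuadraticMap.map_add Q, ← neg_smul, polar_smul_right, polar_comm, hy,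
        QuadraticMap.map_smul, hx]
      simp
    · rw [polar_sub_right, hy, polar_smul_right, polar_self, hx]; simp
  let f : hyperbolicPlane K →qᵢ Q :=
    { toFun := fun v => (v 0 + v 1) • x + (v 0 - v 1) • z
      map_add' := fun v w => by simp only [Pi.add_apply]; module
      map_smul' := fun c v => by
        simp only [Pi.smul_apply, smul_eq_mul, RingHom.id_apply]; module
      map_app' := fun v => by
        simp [QuadraticMap.map_add Q, QuadraticMap.map_smul, hx, hz, hxz, polar_smul_right,
          polar_smul_left, hyperbolicPlane, diag, weightedSumSquares_apply]
        ring }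
  obtain ⟨U, hU⟩ := equivalent_prod_restrict_of_isometry isForm_hyperbolicPlane.2 f
  have := nondegenerate_of_equivalent hU.symm hQ.2
  exact ⟨U, ⟨inferInstance, (nondegenerate_prod_iff.1 this).2⟩,
    hU.trans (equivalent_prodComm _ _)⟩

end Forms

/-! ### Metabolic forms -/

section Metabolic

variable {K : Type u} [Field K] {V W V' W' : Type u}
  [AddCommGroup V] [Module K V] [AddCommGroup W] [Module K W]
  [AddCommGroup V'] [Module K V'] [AddCommGroup W'] [Module K W']

/-- A form is metabolic if it vanishes on a subspace of half the dimension. For nondegenerate forms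
this says that the form is an orthogonal sum of hyperbolic planes. -/
def IsMetabolic (Q : QuadraticForm K V) : Prop :=
  ∃ L : Submodule K V, (∀ x ∈ L, Q x = 0) ∧ 2 * finrank K L = finrank K V

theorem IsMetabolic.of_equivalent {P : QuadraticForm K W} {Q : QuadraticForm K V}
    (h : P.Equivalent Q) (hQ : IsMetabolic Q) : IsMetabolic P := by
  obtain ⟨e⟩ := h
  obtain ⟨L, hL, hd⟩ := hQ
  refine ⟨L.map e.symm.toLinearEquiv.toLinearMap, ?_, ?_⟩
  · rintro _ ⟨x, hx, rfl⟩
    exact (e.symm.map_app x).trans (hL x hx)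
  · exact (congrArg _ (LinearEquiv.finrank_map_eq _ _)).trans
      (hd.trans e.toLinearEquiv.finrank_eq.symm)

theorem IsMetabolic.smul {Q : QuadraticForm K V} (hQ : IsMetabolic Q) (a : K) :
    IsMetabolic (a • Q) := by
  obtain ⟨L, hL, hd⟩ := hQ
  exact ⟨L, fun x hx => by simp [hL x hx], hd⟩

theorem IsMetabolic.prod [FiniteDimensional K V] [FiniteDimensional K W]
    {P : QuadraticForm K W} {Q : QuadraticForm K V}
    (hP : IsMetabolic P) (hQ : IsMetabolic Q) : IsMetabolic (P.prod Q) := by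
  obtain ⟨L, hL, hd⟩ := hP
  obtain ⟨M, hM, hd'⟩ := hQ
  refine ⟨(L.subtype.prodMap M.subtype).range, ?_, ?_⟩
  · rintro _ ⟨⟨x, y⟩, rfl⟩
    simp [hL x x.2, hM y y.2]
  · rw [LinearMap.finrank_range_of_inj (L.subtype_injective.prodMap M.subtype_injective),
      finrank_prod, finrank_prod]
    lia

theorem isMetabolic_of_finrank_eq_zero (Q : QuadraticForm K V) (h : finrank K V = 0) :
    IsMetabolic Q :=
  ⟨⊥, by simp, by simp [h]⟩

theorem equivalent_copies_succ (n : ℕ) (Q : QuadraticForm K V) :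
    (copies (n + 1) Q).Equivalent (Q.prod (copies n Q)) :=
  QuadraticMap.Equivalent.symm
    ⟨⟨Fin.consLinearEquiv K fun _ => V, fun x => by
      simp [copies, Fin.sum_univ_succ]⟩⟩

theorem IsMetabolic.copies [FiniteDimensional K V] {Q : QuadraticForm K V} (hQ : IsMetabolic Q)
    (n : ℕ) : IsMetabolic (copies n Q) := by
  induction n with
  | zero => exact isMetabolic_of_finrank_eq_zero _ finrank_zero_of_subsingleton
  | succ n ih => exact (hQ.prod ih).of_equivalent (equivalent_copies_succ n Q)

theorem isMetabolic_hyperbolicPlane : IsMetabolic (hyperbolicPlane K) := by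
  refine ⟨K ∙ ![1, 1], fun x hx => ?_, ?_⟩
  · obtain ⟨c, rfl⟩ := Submodule.mem_span_singleton.1 hx
    simp [hyperbolicPlane, diag, weightedSumSquares_apply]
  · rw [finrank_span_singleton (by simp)]
    simp

theorem finrank_eq_zero_of_isMetabolic_of_anisotropic {Q : QuadraticForm K V}
    (hQ : IsMetabolic Q) (ha : Q.Anisotropic) : finrank K V = 0 := by
  obtain ⟨L, hL, hd⟩ := hQ
  have : L = ⊥ := (Submodule.eq_bot_iff L).2 fun x hx => ha x (hL x hx)
  rw [← hd, this, finrank_bot]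

variable [NeZero (2 : K)]

/-- Half-dimensional totally isotropic subspaces of nondegenerate forms are self-orthogonal. -/
theorem orthogonal_eq_self_of_finrank [FiniteDimensional K V] {Q : QuadraticForm K V}
    (hQ : Q.Nondegenerate) {L : Submodule K V} (hL : ∀ x ∈ L, Q x = 0)
    (hd : 2 * finrank K L = finrank K V) :
    LinearMap.BilinForm.orthogonal (polarBilin Q) L = L := by
  let : Invertible (2 : K) := invertibleOfNonzero two_ne_zero
  symm
  apply Submodule.eq_of_le_of_finrank_eq
  · intro x hx y hy
    rw [polarBilin_apply_apply, polar, hL _ (L.add_mem hy hx), hL x hx, hL y hy]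
    simp
  · rw [LinearMap.BilinForm.finrank_orthogonal (nondegenerate_polar_iff.2 hQ)]
    lia

/-- Metabolic forms cancel. If `L` and `N` are half-dimensional totally isotropic subspaces for
`Q ⊥ M` and `M`, then so is the projection of `L ∩ (V ⊕ N)` for `Q`. -/
theorem IsMetabolic.of_prod {Q : QuadraticForm K V} {M : QuadraticForm K W}
    (hQ : IsForm Q) (hM : IsForm M) (h : IsMetabolic (Q.prod M)) (h' : IsMetabolic M) :
    IsMetabolic Q := by
  let : Invertible (2 : K) := invertibleOfNonzero two_ne_zero
  have := hQ.1
  have := hM.1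
  obtain ⟨L, hL, hdL⟩ := h
  obtain ⟨N, hN, hdN⟩ := h'
  have hnd := (hQ.prod hM).2
  have hLo := orthogonal_eq_self_of_finrank hnd hL hdL
  have hNo := orthogonal_eq_self_of_finrank hM.2 hN hdN
  -- `L ∩ (V ⊕ N)` is the orthogonal complement of `L + N`, which gives its dimension
  have hS : LinearMap.BilinForm.orthogonal (polarBilin (Q.prod M))
      (L ⊔ N.map (LinearMap.inr K V W)) = L ⊓ N.comap (LinearMap.snd K V W) := by
    ext x
    rw [Submodule.mem_inf, Submodule.mem_comap]
    constructor
    · intro hx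
      refine ⟨hLo ▸ fun y hy => hx y (Submodule.mem_sup_left hy), hNo ▸ fun y hy => ?_⟩
      have := hx (0, y) (Submodule.mem_sup_right ⟨y, hy, rfl⟩)
      simpa using this
    · rintro ⟨h₁, h₂⟩ y hy
      obtain ⟨a, ha, _, ⟨b, hb, rfl⟩, rfl⟩ := Submodule.mem_sup.1 hy
      rw [← hLo] at h₁
      rw [← hNo] at h₂
      have e₁ := h₁ a ha
      have e₂ := h₂ b hb
      rw [map_add, LinearMap.add_apply, e₁]
      simpa using e₂
  have hdS := LinearMap.BilinForm.finrank_orthogonal (nondegenerate_polar_iff.2 hnd)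
    (L ⊔ N.map (LinearMap.inr K V W))
  rw [hS] at hdS
  have hsup := Submodule.finrank_sup_add_finrank_inf_eq L (N.map (LinearMap.inr K V W))
  have hle := Submodule.finrank_le (L ⊔ N.map (LinearMap.inr K V W))
  have hNd : finrank K (N.map (LinearMap.inr K V W)) = finrank K N :=
    (Submodule.equivMapOfInjective _ LinearMap.inr_injective N).symm.finrank_eq
  set S := L ⊓ N.comap (LinearMap.snd K V W) with hSdef
  have hrk := LinearMap.finrank_range_add_finrank_ker ((LinearMap.fst K V W).domRestrict S)
  -- the kernel of the projection of `L ∩ (V ⊕ N)` to `V` is `L ∩ N`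
  have hker : finrank K (LinearMap.ker ((LinearMap.fst K V W).domRestrict S)) =
      finrank K (L ⊓ N.map (LinearMap.inr K V W) : Submodule K (V × W)) := by
    rw [← Submodule.finrank_map_subtype_eq]
    refine congrArg (fun T : Submodule K (V × W) => finrank K T) ?_
    ext ⟨a, b⟩
    simp only [Submodule.mem_map, LinearMap.mem_ker, Submodule.mem_inf]
    constructor
    · rintro ⟨⟨y, hy⟩, h₁, rfl⟩
      obtain rfl : a = 0 := h₁
      exact ⟨hy.1, b, hy.2, rfl⟩
    · rintro ⟨h₁, c, hc, h₂⟩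
      obtain ⟨rfl, rfl⟩ : 0 = a ∧ c = b := by simpa using h₂
      exact ⟨⟨(0, c), h₁, hc⟩, rfl, rfl⟩
  rw [LinearMap.range_domRestrict, hker] at hrk
  rw [finrank_prod] at *
  refine ⟨S.map (LinearMap.fst K V W), ?_, by lia⟩
  rintro _ ⟨⟨a, b⟩, ⟨h₁, h₂⟩, rfl⟩
  have e₁ := hL _ h₁
  have e₂ := hN _ h₂
  simp only [prod_apply, LinearMap.snd_apply] at e₁ e₂
  simpa [e₂] using e₁

/-- A nondegenerate metabolic form is hyperbolic. -/
theorem IsMetabolic.exists_equivalent_copies {Q : QuadraticForm K V} (hQ : IsForm Q)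
    (h : IsMetabolic Q) : ∃ s : ℕ, Q.Equivalent (QForm.copies s (hyperbolicPlane K)) := by
  induction hn : finrank K V using Nat.strong_induction_on generalizing V with
  | _ n ih =>
    have := hQ.1
    by_cases ha : Q.Anisotropic
    · have h0 := finrank_eq_zero_of_isMetabolic_of_anisotropic h ha
      have := finrank_zero_iff.1 h0
      refine ⟨0, ⟨⟨0, fun x => ?_⟩⟩⟩
      rw [Subsingleton.elim x 0]
      simp [QForm.copies]
    · obtain ⟨U, hU, e⟩ := exists_equivalent_prod_hyperbolicPlane hQ ha
      have hU' := IsMetabolic.of_prod hU isForm_hyperbolicPlane (h.of_equivalent e.symm)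
        isMetabolic_hyperbolicPlane
      have hd := e.some.toLinearEquiv.finrank_eq
      rw [finrank_prod] at hd
      obtain ⟨s, hs⟩ := ih (finrank K U) (by simp at hd; lia) hU hU' rfl
      exact ⟨s + 1, e.trans ((hs.prod (.refl _)).trans
        ((equivalent_prodComm _ _).trans (equivalent_copies_succ _ _).symm))⟩

/-- By cancellation, the hyperbolic planes added in Witt equivalence are irrelevant for torsion. -/
theorem isTorsion_iff {Q : QuadraticForm K V} (hQ : IsForm Q) :
    IsTorsion Q ↔ ∃ n : ℕ, 0 < n ∧ IsMetabolic (copies n Q) := by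
  have hH := isMetabolic_hyperbolicPlane (K := K)
  constructor
  · rintro ⟨n, hn, r, s, e⟩
    refine ⟨n, hn, IsMetabolic.of_prod (hQ.copies n) (isForm_hyperbolicPlane.copies r)
      (IsMetabolic.of_equivalent e ?_) (hH.copies r)⟩
    exact (isMetabolic_of_finrank_eq_zero _ finrank_zero_of_subsingleton).prod (hH.copies s)
  · rintro ⟨n, hn, h⟩
    obtain ⟨s, hs⟩ := h.exists_equivalent_copies (hQ.copies n)
    exact ⟨n, hn, 0, s, (equivalent_prod_of_subsingleton_right _ _).trans
      (hs.trans (equivalent_prod_of_subsingleton_left _ _).symm)⟩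

end Metabolic

/-! ### Torsion forms -/

section Torsion

variable {K : Type u} [Field K] {V W : Type u}
  [AddCommGroup V] [Module K V] [AddCommGroup W] [Module K W]

theorem equivalent_copies (n : ℕ) {P : QuadraticForm K W} {Q : QuadraticForm K V}
    (h : P.Equivalent Q) : (copies n P).Equivalent (copies n Q) :=
  QuadraticMap.Equivalent.pi fun _ => h

theorem equivalent_copies_prod (n : ℕ) (P : QuadraticForm K W) (Q : QuadraticForm K V) :
    (copies n (P.prod Q)).Equivalent ((copies n P).prod (copies n Q)) :=
  ⟨⟨{ toFun := fun x => (fun i => (x i).1, fun i => (x i).2)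
      invFun := fun x i => (x.1 i, x.2 i)
      map_add' := fun _ _ => rfl
      map_smul' := fun _ _ => rfl }, fun x => by
        simp [copies, Finset.sum_add_distrib]⟩⟩

theorem copies_smul (n : ℕ) (a : K) (Q : QuadraticForm K V) :
    copies n (a • Q) = a • copies n Q := by
  ext x
  simp [copies, Finset.mul_sum]

variable [NeZero (2 : K)]

theorem IsTorsion.of_equivalent {P : QuadraticForm K W} {Q : QuadraticForm K V} (hQ : IsForm Q)
    (e : P.Equivalent Q) (h : IsTorsion Q) : IsTorsion P := by
  obtain ⟨n, hn, h⟩ := (isTorsion_iff hQ).1 h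
  exact (isTorsion_iff (hQ.of_equivalent e)).2 ⟨n, hn, h.of_equivalent (equivalent_copies n e)⟩

theorem IsTorsion.smul {Q : QuadraticForm K V} (hQ : IsForm Q) (h : IsTorsion Q) {a : K}
    (ha : a ≠ 0) : IsTorsion (a • Q) := by
  obtain ⟨n, hn, h⟩ := (isTorsion_iff hQ).1 h
  exact (isTorsion_iff (hQ.smul ha)).2 ⟨n, hn, by rw [copies_smul]; exact h.smul a⟩

theorem IsTorsion.prod_smul {Q : QuadraticForm K V} (hQ : IsForm Q) (h : IsTorsion Q) {a : K}
    (ha : a ≠ 0) : IsTorsion (Q.prod (a • Q)) := by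
  have := hQ.1
  obtain ⟨n, hn, h⟩ := (isTorsion_iff hQ).1 h
  refine (isTorsion_iff (hQ.prod (hQ.smul ha))).2 ⟨n, hn, ?_⟩
  refine IsMetabolic.of_equivalent (equivalent_copies_prod n _ _) (h.prod ?_)
  rw [copies_smul]
  exact h.smul a

end Torsion

/-! ### Subforms and isometries -/

section Subform

variable {K : Type u} [Field K] {V W : Type u}
  [AddCommGroup V] [Module K V] [AddCommGroup W] [Module K W]

theorem IsSubform.nonempty_isometry {P : QuadraticForm K W} {Q : QuadraticForm K V}
    (h : IsSubform P Q) : Nonempty (P →qᵢ Q) := by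
  obtain ⟨U, _, _, R, -, ⟨e⟩⟩ := h
  exact ⟨e.symm.toIsometry.comp (QuadraticMap.Isometry.inl P R)⟩

theorem isSubform_of_isometry [NeZero (2 : K)] [FiniteDimensional K V] {P : QuadraticForm K W}
    {Q : QuadraticForm K V} (hQ : Q.Anisotropic) (hP : P.Nondegenerate) (f : P →qᵢ Q) :
    IsSubform P Q := by
  obtain ⟨U, e⟩ := equivalent_prod_restrict_of_isometry hP f
  exact ⟨U, inferInstance, inferInstance, Q.restrict U,
    .of_anisotropic fun x hx => Subtype.ext (hQ x hx), e⟩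

theorem equivalent_of_isometry [FiniteDimensional K V] [FiniteDimensional K W]
    {P : QuadraticForm K W} {Q : QuadraticForm K V} (hP : P.Anisotropic) (f : P →qᵢ Q)
    (hd : finrank K V ≤ finrank K W) : P.Equivalent Q := by
  have hf := injective_of_anisotropic hP f
  have hd' := hd.antisymm' (LinearMap.finrank_le_finrank_of_injective (f := f.toLinearMap) hf)
  exact ⟨⟨LinearEquiv.ofInjectiveOfFinrankEq f.toLinearMap hf hd', f.map_app⟩⟩

theorem nonempty_isometry_smul_of_smul {P : QuadraticForm K W} {Q : QuadraticForm K V} (a : K)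
    (h : Nonempty (P →qᵢ Q)) : Nonempty (a • P →qᵢ a • Q) := by
  obtain ⟨f⟩ := h
  exact ⟨⟨f.toLinearMap, fun x => by simp⟩⟩

end Subform

/-! ### Scalar extension -/

section Extend

open scoped TensorProduct

variable {F : Type u} [Field F] [CharZero F] {K : Type u} [Field K] [Algebra F K] {V W : Type u}
  [AddCommGroup V] [Module F V] [AddCommGroup W] [Module F W]

theorem extend_tmul (Q : QuadraticForm F V) (a : K) (x : V) :
    extend K Q (a ⊗ₜ x) = algebraMap F K (Q x) * (a * a) := by
  let : Invertible (2 : F) := invertibleOfNonzero two_ne_zero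
  rw [extend, QuadraticForm.baseChange_tmul, Algebra.smul_def]

theorem extend_one_tmul (Q : QuadraticForm F V) (x : V) :
    extend K Q (1 ⊗ₜ x) = algebraMap F K (Q x) := by
  rw [extend_tmul, mul_one, mul_one]

/-- A form over `K` on a space identified with `K ⊗ V` is the scalar extension of `Q` once it agrees
with it on `V`. -/
theorem equivalent_extend_of_linearEquiv {V' : Type u} [AddCommGroup V'] [Module K V']
    {Q : QuadraticForm F V} {P : QuadraticForm K V'} (e : (K ⊗[F] V) ≃ₗ[K] V')
    (h : ∀ x, P (e (1 ⊗ₜ x)) = algebraMap F K (Q x)) : (extend K Q).Equivalent P := by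
  have : P.comp e.toLinearMap = extend K Q := by
    apply baseChange_ext
    intro x
    rw [extend_one_tmul, ← h]
    rfl
  exact ⟨⟨e, fun x => congr_fun this x⟩⟩

theorem equivalent_extend {P : QuadraticForm F W} {Q : QuadraticForm F V} (h : P.Equivalent Q) :
    (extend K P).Equivalent (extend K Q) := by
  obtain ⟨e⟩ := h
  refine equivalent_extend_of_linearEquiv (e.toLinearEquiv.baseChange F K _ _) fun x => ?_
  rw [← e.map_app, ← extend_one_tmul]
  rfl

theorem equivalent_extend_prod (P : QuadraticForm F W) (Q : QuadraticForm F V) :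
    (extend K (P.prod Q)).Equivalent ((extend K P).prod (extend K Q)) :=
  equivalent_extend_of_linearEquiv (TensorProduct.prodRight F K K W V) fun x => by
    simp [extend_one_tmul]

theorem extend_smul (a : F) (Q : QuadraticForm F V) :
    extend K (a • Q) = algebraMap F K a • extend K Q := by
  apply baseChange_ext
  intro x
  simp [extend_one_tmul, Algebra.smul_def]

theorem equivalent_extend_copies (n : ℕ) (Q : QuadraticForm F V) :
    (extend K (copies n Q)).Equivalent (copies n (extend K Q)) :=
  equivalent_extend_of_linearEquiv (TensorProduct.piRight F K K _) fun x => by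
    simp [copies, extend_one_tmul]

theorem equivalent_extend_weightedSumSquares {ι : Type} [Fintype ι] (w : ι → F) :
    (extend K (weightedSumSquares F w)).Equivalent
      (weightedSumSquares K fun i => algebraMap F K (w i)) := by
  classical
  exact equivalent_extend_of_linearEquiv (TensorProduct.piScalarRight F K K ι) fun x => by
    simp [weightedSumSquares_apply, Algebra.smul_def]

theorem equivalent_extend_hyperbolicPlane :
    (extend K (hyperbolicPlane F)).Equivalent (hyperbolicPlane K) := by
  refine (equivalent_extend_weightedSumSquares _).trans ?_
  have : (fun i => algebraMap F K (![1, -1] i)) = ![1, -1] := by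
    funext i
    fin_cases i <;> simp
  rw [this]
  exact .refl _

theorem IsForm.extend {Q : QuadraticForm F V} (hQ : IsForm Q) : IsForm (extend K Q) := by
  have := hQ.1
  have : CharZero K := charZero_of_injective_algebraMap (algebraMap F K).injective
  obtain ⟨w, e⟩ := exists_equivalent_weightedSumSquares hQ.2
  refine IsForm.of_equivalent ((equivalent_extend e).trans
    (equivalent_extend_weightedSumSquares _)) ⟨inferInstance, nondegenerate_weightedSumSquares ?_⟩
  simp

theorem IsMetabolic.extend {Q : QuadraticForm F V} (hQ : IsForm Q) (h : IsMetabolic Q) :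
    IsMetabolic (extend K Q) := by
  obtain ⟨s, e⟩ := h.exists_equivalent_copies hQ
  exact IsMetabolic.of_equivalent ((equivalent_extend e).trans
    ((equivalent_extend_copies _ _).trans (equivalent_copies s equivalent_extend_hyperbolicPlane)))
    (isMetabolic_hyperbolicPlane.copies s)

theorem IsTorsion.extend {Q : QuadraticForm F V} (hQ : IsForm Q) (h : IsTorsion Q) :
    IsTorsion (extend K Q) := by
  have : CharZero K := charZero_of_injective_algebraMap (algebraMap F K).injective
  obtain ⟨n, hn, h⟩ := (isTorsion_iff hQ).1 h
  exact (isTorsion_iff hQ.extend).2 ⟨n, hn,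
    (h.extend (hQ.copies n)).of_equivalent (equivalent_extend_copies n Q).symm⟩

end Extend

/-! ### Leading coefficients of values of forms over `F((t))` -/

section Springer

variable {F : Type u} [Field F] 

theorem algebraMap_laurentSeries (a : F) : algebraMap F (LaurentSeries F) a = HahnSeries.C a := by
  rfl

theorem t_ne_zero : t F ≠ 0 := by
  simp [t]

theorem coeff_t_mul (x : LaurentSeries F) (k : ℤ) : (t F * x).coeff (k + 1) = x.coeff k := by
  have := HahnSeries.coeff_single_mul_add (r := (1 : F)) (x := x) (a := k) (b := 1)
  simpa [t] using this

theorem coeff_mul_self_of_lt {x : LaurentSeries F} {m k : ℤ} (hx : ∀ i < m, x.coeff i = 0)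
    (hk : k < 2 * m) : (x * x).coeff k = 0 := by
  rw [HahnSeries.coeff_mul]
  refine Finset.sum_eq_zero fun p hp => ?_
  rw [Finset.mem_antidiagonal] at hp
  by_cases h : p.1 < m
  · rw [hx _ h, zero_mul]
  · rw [hx p.2 (by lia), mul_zero]

theorem coeff_mul_self_two_mul {x : LaurentSeries F} {m : ℤ} (hx : ∀ i < m, x.coeff i = 0) :
    (x * x).coeff (2 * m) = x.coeff m * x.coeff m := by
  rw [HahnSeries.coeff_mul, Finset.sum_eq_single (m, m)]
  · intro p hp hne
    rw [Finset.mem_antidiagonal] at hp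
    rcases lt_trichotomy p.1 m with h | h | h
    · rw [hx _ h, zero_mul]
    · exact absurd (Prod.ext h (by simp; lia)) hne
    · rw [hx p.2 (by lia), mul_zero]
  · intro h
    rw [Finset.mem_antidiagonal] at h
    have : x.coeff m = 0 := by
      by_contra h'
      exact h ⟨h', h', by ring⟩
    simp [this]

section

variable {ι κ : Type*} [Fintype ι] [Fintype κ] {w : ι → F} {v : κ → F}
  {y : ι → LaurentSeries F} {z : κ → LaurentSeries F} {m : ℤ}

/-- In even degree `2 m`, where `m` bounds the orders of `y` and `z` from below, only `q₁(y)`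
contributes to `q₁(y) + t q₂(z)`. -/
theorem coeff_two_mul_weightedSumSquares (w : ι → F) (v : κ → F)
    (hy : ∀ i, ∀ k < m, (y i).coeff k = 0) (hz : ∀ j, ∀ k < m, (z j).coeff k = 0) :
    (weightedSumSquares (LaurentSeries F) (fun i => algebraMap F (LaurentSeries F) (w i)) y +
      t F * weightedSumSquares (LaurentSeries F) (fun j => algebraMap F (LaurentSeries F) (v j))
        z).coeff (2 * m) = weightedSumSquares F w fun i => (y i).coeff m := by
  have h : 2 * m = (2 * m - 1) + 1 := by ring
  rw [HahnSeries.coeff_add, h, coeff_t_mul, ← h]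
  simp only [weightedSumSquares_apply, smul_eq_mul, algebraMap_laurentSeries,
    HahnSeries.coeff_sum, HahnSeries.C_mul_eq_smul, HahnSeries.coeff_smul]
  rw [Finset.sum_eq_zero (s := Finset.univ (α := κ)), add_zero]
  · exact Finset.sum_congr rfl fun i _ => by rw [coeff_mul_self_two_mul (hy i)]
  · intro j _
    rw [coeff_mul_self_of_lt (hz j) (by lia), mul_zero]

/-- In odd degree `2 m + 1`, only `q₂(z)` contributes to `q₁(y) + t q₂(z)` once the order of `y`
exceeds `m`. -/
theorem coeff_two_mul_add_one_weightedSumSquares (w : ι → F) (v : κ → F)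
    (hy : ∀ i, ∀ k < m + 1, (y i).coeff k = 0) (hz : ∀ j, ∀ k < m, (z j).coeff k = 0) :
    (weightedSumSquares (LaurentSeries F) (fun i => algebraMap F (LaurentSeries F) (w i)) y +
      t F * weightedSumSquares (LaurentSeries F) (fun j => algebraMap F (LaurentSeries F) (v j))
        z).coeff (2 * m + 1) = weightedSumSquares F v fun j => (z j).coeff m := by
  rw [HahnSeries.coeff_add, coeff_t_mul]
  simp only [weightedSumSquares_apply, smul_eq_mul, algebraMap_laurentSeries,
    HahnSeries.coeff_sum, HahnSeries.C_mul_eq_smul, HahnSeries.coeff_smul]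
  rw [Finset.sum_eq_zero (s := Finset.univ (α := ι)), zero_add]
  · exact Finset.sum_congr rfl fun i _ => by rw [coeff_mul_self_two_mul (hz i)]
  · intro j _
    rw [coeff_mul_self_of_lt (hy j) (by lia), mul_zero]

theorem exists_forall_coeff_eq_zero (y : ι → LaurentSeries F) :
    ∃ N : ℤ, ∀ i, ∀ k < N, (y i).coeff k = 0 := by
  obtain ⟨N, hN⟩ := (Set.finite_range fun i => (y i).order).bddBelow
  exact ⟨N, fun i k hk => HahnSeries.coeff_eq_zero_of_lt_order (hk.trans_le (hN ⟨i, rfl⟩))⟩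

/-- The valuation estimate behind Springer's theorem: the leading coefficients of `y` and `z`
cannot cancel in `q₁(y) + t q₂(z)`, as `q₁` and `q₂` are anisotropic over the residue field and the
two summands have orders of different parity. -/
theorem coeff_eq_zero_of_anisotropic (hw : (weightedSumSquares F w).Anisotropic)
    (hv : (weightedSumSquares F v).Anisotropic)
    (h : ∀ k < 2 * m,
      (weightedSumSquares (LaurentSeries F) (fun i => algebraMap F (LaurentSeries F) (w i)) y +
      t F * weightedSumSquares (LaurentSeries F) (fun j => algebraMap F (LaurentSeries F) (v j))
        z).coeff k = 0) :
    (∀ i, ∀ k < m, (y i).coeff k = 0) ∧ (∀ j, ∀ k < m, (z j).coeff k = 0) := by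
  obtain ⟨N₁, h₁⟩ := exists_forall_coeff_eq_zero y
  obtain ⟨N₂, h₂⟩ := exists_forall_coeff_eq_zero z
  suffices H : ∀ n : ℕ, min N₁ N₂ + n ≤ m → (∀ i, ∀ k < min N₁ N₂ + n, (y i).coeff k = 0) ∧
      (∀ j, ∀ k < min N₁ N₂ + n, (z j).coeff k = 0) by
    rcases le_total m (min N₁ N₂) with hm | hm
    · exact ⟨fun i k hk => h₁ i k (by lia), fun j k hk => h₂ j k (by lia)⟩
    · obtain ⟨n, hn⟩ := Int.eq_ofNat_of_zero_le (sub_nonneg.2 hm)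
      have := H n (by lia)
      rwa [← hn, add_sub_cancel] at this
  intro n
  induction n with
  | zero => exact fun _ => ⟨fun i k hk => h₁ i k (by lia), fun j k hk => h₂ j k (by lia)⟩
  | succ n ih =>
    intro hn
    rw [show min N₁ N₂ + ((n + 1 : ℕ) : ℤ) = min N₁ N₂ + n + 1 by push_cast; ring] at hn ⊢
    obtain ⟨hy, hz⟩ := ih (by lia)
    generalize min N₁ N₂ + (n : ℤ) = M at *
    -- the coefficients of degree `2 M` and `2 M + 1` are values of `q₁` and `q₂` at the coefficients
    -- of degree `M` of `y` and `z`, so these vanish by anisotropy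
    have ey := coeff_two_mul_weightedSumSquares w v hy hz
    rw [h _ (by lia)] at ey
    have ey' := _root_.congr_fun (hw _ ey.symm)
    have hy' : ∀ i, ∀ k < M + 1, (y i).coeff k = 0 := fun i k hk => by
      rcases (Int.lt_add_one_iff.1 hk).lt_or_eq with hk | rfl
      exacts [hy i k hk, ey' i]
    have ez := coeff_two_mul_add_one_weightedSumSquares w v hy' hz
    rw [h _ (by lia)] at ez
    have ez' := _root_.congr_fun (hv _ ez.symm)
    have hz' : ∀ i, ∀ k < M + 1, (z i).coeff k = 0 := fun i k hk => by
      rcases (Int.lt_add_one_iff.1 hk).lt_or_eq with hk | rfl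
      exacts [hz i k hk, ez' i]
    exact ⟨hy', hz'⟩

end

end Springer

/-! ### Square classes of `F((t))` -/

section SquareClasses

variable {F : Type u} [Field F] [CharZero F]

theorem exists_mul_self_eq_of_constantCoeff_eq_one {f : PowerSeries F}
    (hf : PowerSeries.constantCoeff f = 1) :
    ∃ g : PowerSeries F, g * g = f ∧ PowerSeries.constantCoeff g ≠ 0 := by
  -- the binomial series of exponent `1 / 2`, evaluated at `f - 1`
  have h0 : PowerSeries.HasSubst (f - 1) :=
    PowerSeries.HasSubst.of_constantCoeff_zero' (by simp [hf])
  have h : PowerSeries.binomialSeries F (1 / 2 : ℚ) * PowerSeries.binomialSeries F (1 / 2 : ℚ) =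
      1 + PowerSeries.X := by
    rw [← PowerSeries.binomialSeries_add]
    have := PowerSeries.binomialSeries_nat (R := ℚ) (A := F) 1
    norm_num at this ⊢
    exact this
  have hg : (PowerSeries.binomialSeries F (1 / 2 : ℚ)).subst (f - 1) *
      (PowerSeries.binomialSeries F (1 / 2 : ℚ)).subst (f - 1) = f := by
    rw [← PowerSeries.subst_mul h0, h, ← PowerSeries.coe_substAlgHom h0, map_add, map_one,
      PowerSeries.substAlgHom_X]
    ring
  refine ⟨_, hg, fun h0 => ?_⟩
  have := congrArg PowerSeries.constantCoeff hg
  rw [map_mul, h0, hf] at this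
  simp at this

/-- A unit of `F[[t]]` is its residue times the square of a unit of `F((t))`. -/
theorem exists_ofPowerSeries_eq {u : PowerSeries F} (hu : PowerSeries.constantCoeff u ≠ 0) :
    ∃ s : LaurentSeries F, s ≠ 0 ∧ HahnSeries.ofPowerSeries ℤ F u =
      algebraMap F (LaurentSeries F) (PowerSeries.constantCoeff u) * s ^ 2 := by
  obtain ⟨g, hg, hg0⟩ := exists_mul_self_eq_of_constantCoeff_eq_one
    (f := PowerSeries.C (PowerSeries.constantCoeff u)⁻¹ * u) (by simp [hu])
  refine ⟨HahnSeries.ofPowerSeries ℤ F g, fun h => hg0 ?_, ?_⟩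
  · rw [(map_eq_zero_iff _ HahnSeries.ofPowerSeries_injective).1 h, map_zero]
  · rw [pow_two, ← map_mul, hg, map_mul, ← mul_assoc, HahnSeries.ofPowerSeries_C,
      algebraMap_laurentSeries, ← map_mul, mul_inv_cancel₀ hu, map_one, one_mul]

/-- Up to squares, a nonzero Laurent series is either `a` or `t a` for some nonzero constant `a`. -/
theorem exists_eq_or_eq_t_mul {c : LaurentSeries F} (hc : c ≠ 0) :
    ∃ a : F, a ≠ 0 ∧ ∃ s : LaurentSeries F, s ≠ 0 ∧
      (c = algebraMap F (LaurentSeries F) a * s ^ 2 ∨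
        c = t F * (algebraMap F (LaurentSeries F) a * s ^ 2)) := by
  have hu : PowerSeries.constantCoeff c.powerSeriesPart ≠ 0 := by
    rw [← PowerSeries.coeff_zero_eq_constantCoeff_apply, LaurentSeries.powerSeriesPart_coeff]
    simpa using HahnSeries.coeff_order_eq_zero.not.2 hc
  obtain ⟨s, hs, h⟩ := exists_ofPowerSeries_eq hu
  have hcs := LaurentSeries.single_order_mul_powerSeriesPart c
  rw [h, RatFunc.single_zpow, show (HahnSeries.single 1 1 : LaurentSeries F) = t F from rfl]
    at hcs
  refine ⟨_, hu, t F ^ (c.order / 2) * s,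
    mul_ne_zero (zpow_ne_zero _ t_ne_zero) hs, ?_⟩
  rcases Int.emod_two_eq_zero_or_one c.order with h2 | h2
  · left
    nth_rw 1 [← hcs]
    have : c.order = c.order / 2 + c.order / 2 := by lia
    nth_rw 1 [this]
    rw [zpow_add₀ t_ne_zero]
    ring
  · right
    nth_rw 1 [← hcs]
    have : c.order = c.order / 2 + c.order / 2 + 1 := by lia
    nth_rw 1 [this]
    rw [zpow_add₀ t_ne_zero, zpow_add₀ t_ne_zero, zpow_one]
    ring

end SquareClasses

theorem smul_prod {K : Type u} [Field K] {V W : Type u} [AddCommGroup V] [Module K V]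
    [AddCommGroup W] [Module K W] (a : K) (P : QuadraticForm K W) (Q : QuadraticForm K V) :
    a • P.prod Q = (a • P).prod (a • Q) := by
  ext x
  simp [mul_add]

/-! ### The forms `Q₁ ⊥ t Q₂` and Springer's theorem -/

section LaurentSum

open scoped TensorProduct

variable {F : Type u} [Field F] [CharZero F] {V W V' W' : Type u}
  [AddCommGroup V] [Module F V] [AddCommGroup W] [Module F W]
  [AddCommGroup V'] [Module F V'] [AddCommGroup W'] [Module F W']

/-- The form `Q₁ ⊥ t Q₂` over `F((t))` attached to two forms over `F`. -/
noncomputable def laurentSum (Q₁ : QuadraticForm F V) (Q₂ : QuadraticForm F W) :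
    QuadraticForm (LaurentSeries F)
      ((LaurentSeries F ⊗[F] V) × (LaurentSeries F ⊗[F] W)) :=
  (extend (LaurentSeries F) Q₁).prod (t F • extend (LaurentSeries F) Q₂)

theorem equivalent_laurentSum {Q₁ : QuadraticForm F V} {Q₂ : QuadraticForm F W}
    {P₁ : QuadraticForm F V'} {P₂ : QuadraticForm F W'} (h₁ : Q₁.Equivalent P₁)
    (h₂ : Q₂.Equivalent P₂) : (laurentSum Q₁ Q₂).Equivalent (laurentSum P₁ P₂) :=
  (equivalent_extend h₁).prod (equivalent_smul _ (equivalent_extend h₂))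

theorem equivalent_laurentSum_weightedSumSquares {ι κ : Type} [Fintype ι] [Fintype κ]
    {Q₁ : QuadraticForm F V} {Q₂ : QuadraticForm F W} {w : ι → F} {v : κ → F}
    (h₁ : Q₁.Equivalent (weightedSumSquares F w)) (h₂ : Q₂.Equivalent (weightedSumSquares F v)) :
    (laurentSum Q₁ Q₂).Equivalent
      ((weightedSumSquares (LaurentSeries F) fun i => algebraMap F (LaurentSeries F) (w i)).prod
        (t F • weightedSumSquares (LaurentSeries F) fun j =>
          algebraMap F (LaurentSeries F) (v j))) :=
  ((equivalent_extend h₁).trans (equivalent_extend_weightedSumSquares w)).prod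
    (equivalent_smul _ ((equivalent_extend h₂).trans (equivalent_extend_weightedSumSquares v)))

theorem isForm_laurentSum {Q₁ : QuadraticForm F V} {Q₂ : QuadraticForm F W} (h₁ : IsForm Q₁)
    (h₂ : IsForm Q₂) : IsForm (laurentSum Q₁ Q₂) :=
  h₁.extend.prod (h₂.extend.smul t_ne_zero)

theorem equivalent_copies_laurentSum (n : ℕ) (Q₁ : QuadraticForm F V) (Q₂ : QuadraticForm F W) :
    (copies n (laurentSum Q₁ Q₂)).Equivalent (laurentSum (copies n Q₁) (copies n Q₂)) := by
  refine (equivalent_copies_prod n _ _).trans ((equivalent_extend_copies n Q₁).symm.prod ?_)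
  rw [copies_smul]
  exact equivalent_smul _ (equivalent_extend_copies n Q₂).symm

/-- Scaling by a constant, up to squares, scales both summands. -/
theorem equivalent_smul_laurentSum (Q₁ : QuadraticForm F V) (Q₂ : QuadraticForm F W) {a : F}
    {s c : LaurentSeries F} (hs : s ≠ 0) (hc : c = algebraMap F (LaurentSeries F) a * s ^ 2) :
    (c • laurentSum Q₁ Q₂).Equivalent (laurentSum (a • Q₁) (a • Q₂)) := by
  refine ⟨⟨LinearEquiv.smulOfNeZero _ _ s hs, fun x => ?_⟩⟩
  simp [laurentSum, extend_smul, QuadraticMap.map_smul, hc, Algebra.smul_def]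
  ring

/-- Scaling by `t` times a constant, up to squares, also swaps the two summands. -/
theorem equivalent_smul_laurentSum_swap (Q₁ : QuadraticForm F V) (Q₂ : QuadraticForm F W) {a : F}
    {s c : LaurentSeries F} (hs : s ≠ 0)
    (hc : c = t F * (algebraMap F (LaurentSeries F) a * s ^ 2)) :
    (c • laurentSum Q₁ Q₂).Equivalent (laurentSum (a • Q₂) (a • Q₁)) := by
  refine ⟨⟨((LinearEquiv.smulOfNeZero _ _ s hs).prodCongr
    (LinearEquiv.smulOfNeZero _ _ (t F * s) (mul_ne_zero t_ne_zero hs))).trans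
      (LinearEquiv.prodComm _ _ _), fun x => ?_⟩⟩
  simp [laurentSum, extend_smul, QuadraticMap.map_smul, hc, Algebra.smul_def]
  ring

/-- Springer's theorem for `F((t))`: `Q₁ ⊥ t Q₂` is anisotropic if `Q₁` and `Q₂` are. -/
theorem anisotropic_laurentSum [FiniteDimensional F V] [FiniteDimensional F W]
    {Q₁ : QuadraticForm F V} {Q₂ : QuadraticForm F W} (h₁ : Q₁.Anisotropic)
    (h₂ : Q₂.Anisotropic) : (laurentSum Q₁ Q₂).Anisotropic := by
  obtain ⟨w, e₁⟩ := exists_equivalent_weightedSumSquares (nondegenerate_of_anisotropic h₁)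
  obtain ⟨v, e₂⟩ := exists_equivalent_weightedSumSquares (nondegenerate_of_anisotropic h₂)
  refine anisotropic_of_equivalent (equivalent_laurentSum_weightedSumSquares e₁ e₂) ?_
  rintro ⟨y, z⟩ h
  have H (m : ℤ) := coeff_eq_zero_of_anisotropic (m := m) (y := y) (z := z)
    (anisotropic_of_equivalent e₁.symm h₁) (anisotropic_of_equivalent e₂.symm h₂) (by
      intro k _
      rw [QuadraticMap.prod_apply, smul_apply, smul_eq_mul] at h
      rw [h, HahnSeries.coeff_zero])
  refine Prod.ext (funext fun i => ?_) (funext fun j => ?_)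
  · ext k
    exact (H (k + 1)).1 i k (lt_add_one k)
  · ext k
    exact (H (k + 1)).2 j k (lt_add_one k)

/-- An isometry into an anisotropic form over `F((t))` maps integral vectors to integral ones;
reduction modulo `t` therefore gives isometries between the residue forms. -/
theorem nonempty_isometry_of_laurentSum [FiniteDimensional F V] [FiniteDimensional F W]
    {Q₁ : QuadraticForm F V} {Q₂ : QuadraticForm F W} (h₁ : Q₁.Anisotropic)
    (h₂ : Q₂.Anisotropic) {P₁ : QuadraticForm F V'} {P₂ : QuadraticForm F W'}
    (h : Nonempty (laurentSum P₁ P₂ →qᵢ laurentSum Q₁ Q₂)) :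
    Nonempty (P₁ →qᵢ Q₁) ∧ Nonempty (P₂ →qᵢ Q₂) := by
  obtain ⟨w, e₁⟩ := exists_equivalent_weightedSumSquares (nondegenerate_of_anisotropic h₁)
  obtain ⟨v, e₂⟩ := exists_equivalent_weightedSumSquares (nondegenerate_of_anisotropic h₂)
  have a₁ := anisotropic_of_equivalent e₁.symm h₁
  have a₂ := anisotropic_of_equivalent e₂.symm h₂
  obtain ⟨f⟩ := h
  obtain ⟨e⟩ := equivalent_laurentSum_weightedSumSquares e₁ e₂
  let g := e.toIsometry.comp f
  have hsmul (c : F) (x : LaurentSeries F) : (algebraMap F (LaurentSeries F) c * x).coeff 0 =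
      c * x.coeff 0 := by
    rw [algebraMap_laurentSeries, HahnSeries.C_mul_eq_smul, HahnSeries.coeff_smul, smul_eq_mul]
  constructor
  · have hg (x : V') : weightedSumSquares (LaurentSeries F)
        (fun i => algebraMap F (LaurentSeries F) (w i)) (g (1 ⊗ₜ x, 0)).1 +
        t F * weightedSumSquares (LaurentSeries F)
        (fun j => algebraMap F (LaurentSeries F) (v j)) (g (1 ⊗ₜ x, 0)).2 =
          algebraMap F (LaurentSeries F) (P₁ x) := by
      have := g.map_app (1 ⊗ₜ x, 0)
      rw [QuadraticMap.prod_apply, smul_apply, smul_eq_mul] at this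
      rw [this]
      simp [laurentSum, extend_one_tmul]
    let l : P₁ →qᵢ weightedSumSquares F fun i => (w i : F) :=
      { toFun := fun x i => ((g (1 ⊗ₜ x, 0)).1 i).coeff 0
        map_add' := fun x y => by
          have : ((1 : LaurentSeries F) ⊗ₜ[F] (x + y), (0 : LaurentSeries F ⊗[F] W')) =
            (1 ⊗ₜ x, 0) + (1 ⊗ₜ y, 0) := by simp [TensorProduct.tmul_add]
          rw [this, map_add]
          rfl
        map_smul' := fun c x => by
          have : ((1 : LaurentSeries F) ⊗ₜ[F] (c • x), (0 : LaurentSeries F ⊗[F] W')) =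
              algebraMap F (LaurentSeries F) c • (1 ⊗ₜ x, 0) := by
            simp
          rw [this, map_smul]
          funext i
          exact hsmul _ _
        map_app' := fun x => by
          obtain ⟨hy, hz⟩ := coeff_eq_zero_of_anisotropic (m := 0) (y := (g (1 ⊗ₜ x, 0)).1)
            (z := (g (1 ⊗ₜ x, 0)).2) a₁ a₂ (by
              intro k hk
              rw [hg, algebraMap_laurentSeries, HahnSeries.C_apply,
                HahnSeries.coeff_single_of_ne (by lia)])
          have := coeff_two_mul_weightedSumSquares (fun i => (w i : F)) (fun j => (v j : F)) hy hz
          rw [hg, algebraMap_laurentSeries, HahnSeries.C_apply, mul_zero,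
            HahnSeries.coeff_single_same] at this
          exact this.symm }
    exact ⟨e₁.some.symm.toIsometry.comp l⟩
  · have hg (x : W') : weightedSumSquares (LaurentSeries F)
        (fun i => algebraMap F (LaurentSeries F) (w i)) (g (0, 1 ⊗ₜ x)).1 +
        t F * weightedSumSquares (LaurentSeries F)
        (fun j => algebraMap F (LaurentSeries F) (v j)) (g (0, 1 ⊗ₜ x)).2 =
          t F * algebraMap F (LaurentSeries F) (P₂ x) := by
      have := g.map_app (0, 1 ⊗ₜ x)
      rw [QuadraticMap.prod_apply, smul_apply, smul_eq_mul] at this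
      rw [this]
      simp [laurentSum, extend_one_tmul]
    have hcoeff (c : F) (k : ℤ) (hk : k ≠ 1) :
        (t F * algebraMap F (LaurentSeries F) c).coeff k = 0 := by
      have := coeff_t_mul (algebraMap F (LaurentSeries F) c) (k - 1)
      rw [sub_add_cancel] at this
      rw [this, algebraMap_laurentSeries, HahnSeries.C_apply,
        HahnSeries.coeff_single_of_ne (by lia)]
    let l : P₂ →qᵢ weightedSumSquares F fun j => (v j : F) :=
      { toFun := fun x i => ((g (0, 1 ⊗ₜ x)).2 i).coeff 0
        map_add' := fun x y => by
          have : ((0 : LaurentSeries F ⊗[F] V'), (1 : LaurentSeries F) ⊗ₜ[F] (x + y)) =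
            (0, 1 ⊗ₜ x) + (0, 1 ⊗ₜ y) := by simp [TensorProduct.tmul_add]
          rw [this, map_add]
          rfl
        map_smul' := fun c x => by
          have : ((0 : LaurentSeries F ⊗[F] V'), (1 : LaurentSeries F) ⊗ₜ[F] (c • x)) =
              algebraMap F (LaurentSeries F) c • (0, 1 ⊗ₜ x) := by
            simp
          rw [this, map_smul]
          funext i
          exact hsmul _ _
        map_app' := fun x => by
          obtain ⟨hy, hz⟩ := coeff_eq_zero_of_anisotropic (m := 0) (y := (g (0, 1 ⊗ₜ x)).1)
            (z := (g (0, 1 ⊗ₜ x)).2) a₁ a₂ (by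
              intro k hk
              rw [hg, hcoeff _ _ (by lia)])
          -- the first component vanishes modulo `t`, as the value is divisible by `t`
          have hy' : ∀ i, ∀ k < (0 : ℤ) + 1, ((g (0, 1 ⊗ₜ x)).1 i).coeff k = 0 := by
            have := coeff_two_mul_weightedSumSquares (fun i => (w i : F)) (fun j => (v j : F))
              hy hz
            rw [hg, hcoeff _ _ (by lia)] at this
            have := _root_.congr_fun (a₁ _ this.symm)
            intro i k hk
            rcases (Int.lt_add_one_iff.1 hk).lt_or_eq with hk | rfl
            exacts [hy i k hk, this i]
          have := coeff_two_mul_add_one_weightedSumSquares (fun i => (w i : F))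
            (fun j => (v j : F)) hy' hz
          rw [hg, mul_zero, coeff_t_mul, algebraMap_laurentSeries, HahnSeries.C_apply,
            HahnSeries.coeff_single_same] at this
          exact this.symm }
    exact ⟨e₂.some.symm.toIsometry.comp l⟩

/-- The residue forms of a metabolic form are metabolic: by cancellation hyperbolic planes may be
split off both residue forms until they are anisotropic, and then they have to be zero. -/
theorem isMetabolic_of_laurentSum {Q₁ : QuadraticForm F V} {Q₂ : QuadraticForm F W}
    (h₁ : IsForm Q₁) (h₂ : IsForm Q₂) (h : IsMetabolic (laurentSum Q₁ Q₂)) :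
    IsMetabolic Q₁ ∧ IsMetabolic Q₂ := by
  induction hn : finrank F V + finrank F W using Nat.strong_induction_on generalizing V W with
  | _ n ih =>
    have := h₁.1
    have := h₂.1
    have hH := isMetabolic_hyperbolicPlane (K := F)
    have hF := isForm_hyperbolicPlane (K := F)
    by_cases a₁ : Q₁.Anisotropic
    · by_cases a₂ : Q₂.Anisotropic
      · have := finrank_eq_zero_of_isMetabolic_of_anisotropic h (anisotropic_laurentSum a₁ a₂)
        rw [finrank_prod, Module.finrank_baseChange, Module.finrank_baseChange] at this
        exact ⟨isMetabolic_of_finrank_eq_zero _ (by lia),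
          isMetabolic_of_finrank_eq_zero _ (by lia)⟩
      · obtain ⟨U, hU, e⟩ := exists_equivalent_prod_hyperbolicPlane h₂ a₂
        have hd := e.some.toLinearEquiv.finrank_eq
        rw [finrank_prod, finrank_fin_fun] at hd
        have key : (laurentSum Q₁ Q₂).Equivalent ((laurentSum Q₁ (Q₂.restrict U)).prod
            (t F • extend (LaurentSeries F) (hyperbolicPlane F))) := by
          refine (equivalent_laurentSum (.refl _) e).trans (.trans ?_
            (equivalent_prodAssoc _ _ _).symm)
          refine (QuadraticMap.Equivalent.refl _).prod ?_
          rw [← smul_prod]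
          exact equivalent_smul (t F) (equivalent_extend_prod _ _)
        obtain ⟨m₁, m₂⟩ := ih _ (by lia) h₁ hU (IsMetabolic.of_prod (isForm_laurentSum h₁ hU)
          (hF.extend.smul t_ne_zero) (h.of_equivalent key.symm) ((hH.extend hF).smul _)) rfl
        exact ⟨m₁, (m₂.prod hH).of_equivalent e⟩
    · obtain ⟨U, hU, e⟩ := exists_equivalent_prod_hyperbolicPlane h₁ a₁
      have hd := e.some.toLinearEquiv.finrank_eq
      rw [finrank_prod, finrank_fin_fun] at hd
      have key : (laurentSum Q₁ Q₂).Equivalent ((laurentSum (Q₁.restrict U) Q₂).prod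
          (extend (LaurentSeries F) (hyperbolicPlane F))) := by
        refine (equivalent_laurentSum e (.refl _)).trans (.trans ?_
          (equivalent_prodAssoc _ _ _).symm)
        refine .trans (.prod (equivalent_extend_prod _ _) (.refl _)) ?_
        exact (equivalent_prodAssoc _ _ _).trans
          ((QuadraticMap.Equivalent.refl _).prod (equivalent_prodComm _ _))
      obtain ⟨m₁, m₂⟩ := ih _ (by lia) hU h₂ (IsMetabolic.of_prod (isForm_laurentSum hU h₂)
        hF.extend (h.of_equivalent key.symm) (hH.extend hF)) rfl
      exact ⟨(m₁.prod hH).of_equivalent e, m₂⟩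

theorem isTorsion_of_laurentSum {Q₁ : QuadraticForm F V} {Q₂ : QuadraticForm F W}
    (h₁ : IsForm Q₁) (h₂ : IsForm Q₂) (h : IsTorsion (laurentSum Q₁ Q₂)) :
    IsTorsion Q₁ ∧ IsTorsion Q₂ := by
  obtain ⟨n, hn, h⟩ := (isTorsion_iff (isForm_laurentSum h₁ h₂)).1 h
  obtain ⟨m₁, m₂⟩ := isMetabolic_of_laurentSum (h₁.copies n) (h₂.copies n)
    (h.of_equivalent (equivalent_copies_laurentSum n Q₁ Q₂).symm)
  exact ⟨(isTorsion_iff h₁).2 ⟨n, hn, m₁⟩, (isTorsion_iff h₂).2 ⟨n, hn, m₂⟩⟩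

theorem isTorsion_laurentSum_smul {Q : QuadraticForm F V} (hQ : IsForm Q) (h : IsTorsion Q) {a : F}
    (ha : a ≠ 0) : IsTorsion (laurentSum Q (a • Q)) := by
  rw [laurentSum, extend_smul, smul_smul]
  exact (h.extend hQ).prod_smul hQ.extend (mul_ne_zero t_ne_zero (by simpa using ha))

/-- Every form over `F((t))` is isometric to `Q₁ ⊥ t Q₂` for some forms `Q₁` and `Q₂` over `F`. -/
theorem exists_equivalent_laurentSum {V : Type u} [AddCommGroup V] [Module (LaurentSeries F) V]
    {Q : QuadraticForm (LaurentSeries F) V} (hQ : IsForm Q) :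
    ∃ (n : ℕ) (p : Fin n → Prop) (Q₁ : QuadraticForm F ({i // p i} → F))
      (Q₂ : QuadraticForm F ({i // ¬ p i} → F)), IsForm Q₁ ∧ IsForm Q₂ ∧
        Q.Equivalent (laurentSum Q₁ Q₂) := by
  classical
  have := hQ.1
  obtain ⟨w, e⟩ := exists_equivalent_weightedSumSquares hQ.2
  choose a ha s hs h using fun i => exists_eq_or_eq_t_mul (w i).ne_zero
  let p i := (w i : LaurentSeries F) = algebraMap F (LaurentSeries F) (a i) * s i ^ 2
  refine ⟨_, p, weightedSumSquares F fun i => a i, weightedSumSquares F fun i => a i,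
    ⟨inferInstance, nondegenerate_weightedSumSquares fun i => ha i⟩,
    ⟨inferInstance, nondegenerate_weightedSumSquares fun i => ha i⟩, e.trans ?_⟩
  refine .trans ?_ (equivalent_laurentSum_weightedSumSquares (.refl _) (.refl _)).symm
  refine ⟨⟨((LinearEquiv.piCongrRight fun i => LinearEquiv.smulOfNeZero _ _ (s i) (hs i)).trans
    (LinearEquiv.funCongrLeft _ _ (Equiv.sumCompl p))).trans
    (LinearEquiv.sumArrowLequivProdArrow _ _ _ _), fun x => ?_⟩⟩
  have hp (i : {i // p i}) : (w i : LaurentSeries F) = _ := i.2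
  have hn (i : {i // ¬ p i}) : (w i : LaurentSeries F) = _ := (h i).resolve_left i.2
  simp only [QuadraticMap.prod_apply, smul_apply, weightedSumSquares_apply, smul_eq_mul]
  rw [← (Equiv.sumCompl p).sum_comp, Fintype.sum_sum_type, Finset.mul_sum]
  congr 1
  · refine Finset.sum_congr rfl fun i _ => ?_
    simp [hp]
    ring
  · refine Finset.sum_congr rfl fun i _ => ?_
    simp [hn]
    ring

end LaurentSum

/-! ### Round forms and Pfister forms -/

section Round

open scoped TensorProduct

variable {F : Type u} [Field F] {V W : Type u}
  [AddCommGroup V] [Module F V] [AddCommGroup W] [Module F W]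

theorem equivalent_sq_smul (Q : QuadraticForm F V) {a : F} (ha : a ≠ 0) :
    (a ^ 2 • Q).Equivalent Q :=
  ⟨⟨LinearEquiv.smulOfNeZero _ _ a ha, fun x => by simp [QuadraticMap.map_smul, pow_two]⟩⟩

/-- A nonzero form is round if its nonzero values are similarity factors. -/
def IsRound (Q : QuadraticForm F V) : Prop :=
  (∃ x, Q x ≠ 0) ∧ ∀ x, Q x ≠ 0 → (Q x • Q).Equivalent Q

theorem IsRound.of_equivalent {P : QuadraticForm F W} {Q : QuadraticForm F V}
    (h : P.Equivalent Q) (hQ : IsRound Q) : IsRound P := by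
  obtain ⟨e⟩ := h
  obtain ⟨⟨x, hx⟩, hQ⟩ := hQ
  refine ⟨⟨e.symm x, by rwa [e.symm.map_app]⟩, fun y hy => ?_⟩
  rw [← e.map_app] at hy ⊢
  exact (equivalent_smul _ ⟨e⟩).trans ((hQ _ hy).trans ⟨e.symm⟩)

/-- The isometry `⟨u, z⟩ ⊗ P ≅ ⟨u + z, u z (u + z)⟩ ⊗ P`. -/
theorem equivalent_smul_prod_smul (P : QuadraticForm F V) {u z : F} (h : u + z ≠ 0) :
    ((u • P).prod (z • P)).Equivalent
      (((u + z) • P).prod ((u * z * (u + z)) • P)) := by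
  -- the vectors `(1, 1)` and `(z, -u)` are orthogonal, with values `u + z` and `u z (u + z)`
  refine QuadraticMap.Equivalent.symm ⟨⟨
    { toFun := fun x => (x.1 + z • x.2, x.1 - u • x.2)
      invFun := fun x => ((u + z)⁻¹ • (u • x.1 + z • x.2), (u + z)⁻¹ • (x.1 - x.2))
      map_add' := fun x y => by ext <;> simp <;> module
      map_smul' := fun c x => by ext <;> simp <;> module
      left_inv := fun x => by
        ext
        · have : u • (x.1 + z • x.2) + z • (x.1 - u • x.2) = (u + z) • x.1 := by module
          simp only [this, inv_smul_smul₀ h]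
        · have : (x.1 + z • x.2) - (x.1 - u • x.2) = (u + z) • x.2 := by module
          simp only [this, inv_smul_smul₀ h]
      right_inv := fun x => by
        have e (a : F) : a • (u + z)⁻¹ • (x.1 - x.2) = (u + z)⁻¹ • (a • (x.1 - x.2)) :=
          smul_comm _ _ _
        ext
        · have : (u • x.1 + z • x.2) + z • (x.1 - x.2) = (u + z) • x.1 := by module
          simp only [e, ← smul_add, this, inv_smul_smul₀ h]
        · have : (u • x.1 + z • x.2) - u • (x.1 - x.2) = (u + z) • x.2 := by module
          simp only [e, ← smul_sub, this, inv_smul_smul₀ h] }, fun x => ?_⟩⟩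
  simp [sub_eq_add_neg, ← neg_smul, QuadraticMap.map_add P, QuadraticMap.map_smul,
    polar_smul_right]
  ring

/-- Roundness passes from `P` to `P ⊥ -aP`. If `u = P x` and `z = -a P y` are nonzero, then
`P ⊥ -aP ≅ uP ⊥ zP` can be rewritten with the value `u + z` as first coefficient. -/
theorem IsRound.prod_neg_smul {P : QuadraticForm F V} (hP : IsRound P) {a : F} (ha : a ≠ 0) :
    IsRound (P.prod (-a • P)) := by
  obtain ⟨⟨x₀, hx₀⟩, hP⟩ := hP
  refine ⟨⟨(x₀, 0), by simpa using hx₀⟩, ?_⟩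
  rintro ⟨x, y⟩ hxy
  simp only [QuadraticMap.prod_apply, smul_apply, smul_eq_mul] at hxy ⊢
  rw [smul_prod]
  by_cases hy : P y = 0
  · rw [hy, mul_zero, add_zero] at hxy ⊢
    refine (hP x hxy).prod ?_
    rw [smul_comm]
    exact equivalent_smul _ (hP x hxy)
  by_cases hx : P x = 0
  · rw [hx, zero_add, mul_smul]
    refine QuadraticMap.Equivalent.trans ?_ (equivalent_prodComm (-a • P) P)
    refine (equivalent_smul _ (hP y hy)).prod ?_
    rw [smul_smul, show -a * P y * -a = a ^ 2 * P y by ring, mul_smul]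
    exact (equivalent_smul _ (hP y hy)).trans (equivalent_sq_smul P ha)
  · refine QuadraticMap.Equivalent.symm ?_
    have e₁ : (P.prod (-a • P)).Equivalent ((P x • P).prod ((-a * P y) • P)) := by
      rw [mul_smul]
      exact (hP x hx).symm.prod (equivalent_smul _ (hP y hy).symm)
    refine e₁.trans ((equivalent_smul_prod_smul P hxy).trans (.prod (.refl _) ?_))
    rw [show P x * (-a * P y) * (P x + -a * P y) = (P x + -a * P y) * -a * P x * P y by ring,
      mul_smul, mul_smul, mul_smul]
    exact equivalent_smul _ (equivalent_smul _ ((equivalent_smul _ (hP y hy)).trans (hP x hx)))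

variable [CharZero F]

theorem equivalent_tensor_pfister (P : QuadraticForm F V) (a : F) :
    (tensor P (pfister a)).Equivalent (P.prod (-a • P)) := by
  let : Invertible (2 : F) := invertibleOfNonzero two_ne_zero
  let e : (V ⊗[F] (Fin 2 → F)) ≃ₗ[F] V × V :=
    (TensorProduct.piScalarRight F F V (Fin 2)).trans (LinearEquiv.finTwoArrow F V)
  have he (x : V × V) : e.symm x = x.1 ⊗ₜ Pi.single 0 1 + x.2 ⊗ₜ Pi.single 1 1 := by
    rw [LinearEquiv.symm_apply_eq]
    ext <;> simp [e]
  refine QuadraticMap.Equivalent.symm ⟨⟨e.symm, fun x => ?_⟩⟩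
  have hp : polar (tensor P (pfister a)) (x.1 ⊗ₜ Pi.single 0 1) (x.2 ⊗ₜ Pi.single 1 1) = 0 := by
    rw [← polarBilin_apply_apply, tensor, QuadraticForm.polarBilin_tmul]
    simp [pfister, diag, polar, weightedSumSquares_apply]
  have hv (v : V) (c : Fin 2 → F) : tensor P (pfister a) (v ⊗ₜ c) = pfister a c * P v :=
    QuadraticForm.tensorDistrib_tmul _ _ _ _
  change tensor P (pfister a) (e.symm x) = _
  rw [he, QuadraticMap.map_add (tensor P (pfister a)), hp, hv, hv]
  simp [pfister, diag, weightedSumSquares_apply]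

theorem equivalent_pfister_tensor (P : QuadraticForm F V) (a : F) :
    (tensor (pfister a) P).Equivalent (P.prod (-a • P)) := by
  let : Invertible (2 : F) := invertibleOfNonzero two_ne_zero
  exact .trans ⟨QuadraticForm.tensorComm _ _⟩ (equivalent_tensor_pfister P a)

/-- Pfister forms are round. -/
theorem IsPfister.isRound {n : ℕ} {Q : QuadraticForm F V} (h : IsPfister n Q) : IsRound Q := by
  induction h with
  | zero Q h =>
    refine IsRound.of_equivalent h ⟨⟨![1], by simp [diag, weightedSumSquares_apply]⟩, ?_⟩
    intro x hx
    have : diag ![(1 : F)] x = x 0 ^ 2 := by simp [diag, weightedSumSquares_apply, pow_two]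
    rw [this] at hx ⊢
    exact equivalent_sq_smul _ (by simpa using hx)
  | succ Q P a ha _ h ih =>
    exact (ih.prod_neg_smul ha).of_equivalent (h.trans (equivalent_pfister_tensor P a))

end Round

/-! ### Supreme torsion forms -/

section Supreme

variable {K : Type u} [Field K] [NeZero (2 : K)] {V W : Type u}
  [AddCommGroup V] [Module K V] [AddCommGroup W] [Module K W]

theorem IsSupremeTorsionForm.of_equivalent {P : QuadraticForm K W} {Q : QuadraticForm K V}
    (e : P.Equivalent Q) (hQ : IsSupremeTorsionForm Q) : IsSupremeTorsionForm P where
  isForm := hQ.isForm.of_equivalent e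
  anisotropic := anisotropic_of_equivalent e hQ.anisotropic
  torsion := hQ.torsion.of_equivalent hQ.isForm e
  supreme W' _ _ R h₁ h₂ h₃ := by
    obtain ⟨a, ha, U, _, _, S, hS, e'⟩ := hQ.supreme W' R h₁ h₂ h₃
    exact ⟨a, ha, U, _, _, S, hS, e.trans e'⟩

/-- All nonzero scalars are similarity factors of a round supreme torsion form `φ`: as `φ ⊥ -aφ` is
a torsion form of larger dimension, it is isotropic, so that `a` is a quotient of values of `φ`. -/
theorem equivalent_smul_of_isRound {φ : QuadraticForm K V} (hr : IsRound φ)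
    (hφ : IsSupremeTorsionForm φ) {a : K} (ha : a ≠ 0) : (a • φ).Equivalent φ := by
  have hF := hφ.isForm
  have := hF.1
  have hi : ¬ (φ.prod (-a • φ)).Anisotropic := by
    intro h
    obtain ⟨c, hc, hs⟩ := hφ.supreme _ _ (hF.prod (hF.smul (neg_ne_zero.2 ha))) h
      (hφ.torsion.prod_smul hF (neg_ne_zero.2 ha))
    obtain ⟨f⟩ := hs.nonempty_isometry
    have hle := LinearMap.finrank_le_finrank_of_injective (f := f.toLinearMap)
      (injective_of_anisotropic (anisotropic_smul h hc) f)
    obtain ⟨x, hx⟩ := hr.1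
    have : Nontrivial V := ⟨x, 0, fun h => hx (by rw [h, QuadraticMap.map_zero])⟩
    have := finrank_pos (R := K) (M := V)
    rw [finrank_prod] at hle
    lia
  obtain ⟨⟨x, y⟩, hne, hxy⟩ := (not_anisotropic_iff_exists _).1 hi
  have hxy : φ x = a * φ y := by
    simp only [QuadraticMap.prod_apply, smul_apply, smul_eq_mul] at hxy
    linear_combination hxy
  have hy : φ y ≠ 0 := by
    intro hy
    rw [hy, mul_zero] at hxy
    exact hne (by rw [hφ.anisotropic _ hxy, hφ.anisotropic _ hy]; rfl)
  have hx : φ x ≠ 0 := by rw [hxy]; exact mul_ne_zero ha hy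
  refine (equivalent_smul a (hr.2 y hy)).symm.trans ?_
  rw [smul_smul, ← hxy]
  exact hr.2 x hx

end Supreme

/-! ### Supreme torsion forms over `F((t))` -/

section LaurentSupreme

open scoped TensorProduct

variable {F : Type u} [Field F] [CharZero F] {V W V' W' : Type u}
  [AddCommGroup V] [Module F V] [AddCommGroup W] [Module F W]
  [AddCommGroup V'] [Module F V'] [AddCommGroup W'] [Module F W']

theorem nonempty_isometry_extend {K : Type u} [Field K] [Algebra F K] {P : QuadraticForm F W}
    {Q : QuadraticForm F V} (h : Nonempty (P →qᵢ Q)) :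
    Nonempty (extend K P →qᵢ extend K Q) := by
  obtain ⟨f⟩ := h
  have : (extend K Q).comp (f.toLinearMap.baseChange K) = extend K P := by
    apply baseChange_ext
    intro x
    simp [extend_one_tmul]
  exact ⟨⟨f.toLinearMap.baseChange K, fun x => congr_fun this x⟩⟩

theorem nonempty_isometry_laurentSum {P₁ : QuadraticForm F V'} {P₂ : QuadraticForm F W'}
    {Q₁ : QuadraticForm F V} {Q₂ : QuadraticForm F W} (h₁ : Nonempty (P₁ →qᵢ Q₁))
    (h₂ : Nonempty (P₂ →qᵢ Q₂)) : Nonempty (laurentSum P₁ P₂ →qᵢ laurentSum Q₁ Q₂) := by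
  obtain ⟨f⟩ := nonempty_isometry_extend (K := LaurentSeries F) h₁
  obtain ⟨g⟩ := nonempty_isometry_extend (K := LaurentSeries F) h₂
  exact ⟨⟨f.toLinearMap.prodMap g.toLinearMap, fun x => by simp [laurentSum]⟩⟩

theorem anisotropic_of_extend {K : Type u} [Field K] [Algebra F K] {Q : QuadraticForm F V}
    (hQ : IsForm Q) (h : (extend K Q).Anisotropic) : Q.Anisotropic := by
  have := hQ.1
  obtain ⟨w, e⟩ := exists_equivalent_weightedSumSquares hQ.2
  refine anisotropic_of_equivalent e fun x hx => ?_
  have h := anisotropic_of_equivalent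
    ((equivalent_extend e).trans (equivalent_extend_weightedSumSquares _)).symm h
  have := h (fun i => algebraMap F K (x i)) (by
    have := congrArg (algebraMap F K) hx
    simpa [weightedSumSquares_apply] using this)
  funext i
  simpa using _root_.congr_fun this i

theorem anisotropic_of_laurentSum {Q₁ : QuadraticForm F V} {Q₂ : QuadraticForm F W}
    (h₁ : IsForm Q₁) (h₂ : IsForm Q₂) (h : (laurentSum Q₁ Q₂).Anisotropic) :
    Q₁.Anisotropic ∧ Q₂.Anisotropic := by
  obtain ⟨a₁, a₂⟩ := anisotropic_of_prod h
  exact ⟨anisotropic_of_extend h₁ a₁, anisotropic_of_extend h₂ fun x hx => a₂ x (by simp [hx])⟩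

/-- The hypothesis `hs` removes the similarity factors: all anisotropic torsion forms over `F` are
subforms of `φ ≅ -φ`, so the two residue forms may be embedded independently. -/
theorem isSupremeTorsionForm_laurentSum {φ : QuadraticForm F V} (hφ : IsSupremeTorsionForm φ)
    (hs : ∀ a : F, a ≠ 0 → (a • φ).Equivalent φ) :
    IsSupremeTorsionForm (laurentSum φ ((-1 : F) • φ)) := by
  have h1 : (-1 : F) ≠ 0 := by simp
  have hF := hφ.isForm
  have := hF.1
  have ha := anisotropic_laurentSum hφ.anisotropic (anisotropic_smul hφ.anisotropic h1)
  refine ⟨isForm_laurentSum hF (hF.smul h1), ha, isTorsion_laurentSum_smul hF hφ.torsion h1, ?_⟩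
  intro W _ _ P hP haP htP
  obtain ⟨n, p, Q₁, Q₂, f₁, f₂, e⟩ := exists_equivalent_laurentSum hP
  have hL := isForm_laurentSum f₁ f₂
  obtain ⟨a₁, a₂⟩ := anisotropic_of_laurentSum f₁ f₂ (anisotropic_of_equivalent e.symm haP)
  obtain ⟨t₁, t₂⟩ := isTorsion_of_laurentSum f₁ f₂ (htP.of_equivalent hP e.symm)
  have key {U : Type u} [AddCommGroup U] [Module F U] (R : QuadraticForm F U) (hR : IsForm R)
      (haR : R.Anisotropic) (htR : IsTorsion R) : Nonempty (R →qᵢ φ) := by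
    obtain ⟨c, hc, hsub⟩ := hφ.supreme U R hR haR htR
    obtain ⟨f⟩ := nonempty_isometry_smul_of_smul c⁻¹ hsub.nonempty_isometry
    rw [inv_smul_smul₀ hc] at f
    obtain ⟨g⟩ := hs c⁻¹ (inv_ne_zero hc)
    exact ⟨g.toIsometry.comp f⟩
  obtain ⟨g⟩ := hs (-1) h1
  obtain ⟨f⟩ := nonempty_isometry_laurentSum (key Q₁ f₁ a₁ t₁)
    ((key Q₂ f₂ a₂ t₂).map g.symm.toIsometry.comp)
  refine ⟨1, one_ne_zero, ?_⟩
  rw [one_smul]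
  exact isSubform_of_isometry ha hP.2 (f.comp e.some.toIsometry)

/-- An anisotropic torsion form `ρ` over `F` gives the anisotropic torsion form `ρ ⊥ -tρ` over
`F((t))`. Comparing residue forms shows that if the latter is similar to a subform of `Q₁ ⊥ t Q₂`,
then `ρ` and `-ρ` map to `Q₁` and `Q₂` after scaling by a common factor. -/
theorem exists_isometry_of_isSupremeTorsionForm_laurentSum {Q₁ : QuadraticForm F V}
    {Q₂ : QuadraticForm F W} (h₁ : IsForm Q₁) (h₂ : IsForm Q₂)
    (h : IsSupremeTorsionForm (laurentSum Q₁ Q₂)) {ρ : QuadraticForm F V'} (hρ : IsForm ρ)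
    (ha : ρ.Anisotropic) (ht : IsTorsion ρ) :
    ∃ a : F, a ≠ 0 ∧ Nonempty (a • ρ →qᵢ Q₁) ∧ Nonempty (-a • ρ →qᵢ Q₂) := by
  have := h₁.1
  have := h₂.1
  have := hρ.1
  have h1 : (-1 : F) ≠ 0 := by simp
  obtain ⟨a₁, a₂⟩ := anisotropic_of_laurentSum h₁ h₂ h.anisotropic
  obtain ⟨c, hc, hsub⟩ := h.supreme _ (laurentSum ρ ((-1 : F) • ρ))
    (isForm_laurentSum hρ (hρ.smul h1)) (anisotropic_laurentSum ha (anisotropic_smul ha h1))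
    (isTorsion_laurentSum_smul hρ ht h1)
  obtain ⟨f⟩ := hsub.nonempty_isometry
  obtain ⟨a, ha0, s, hs, hcs | hcs⟩ := exists_eq_or_eq_t_mul hc
  · obtain ⟨e⟩ := equivalent_smul_laurentSum ρ ((-1 : F) • ρ) hs hcs
    have := nonempty_isometry_of_laurentSum a₁ a₂ ⟨f.comp e.symm.toIsometry⟩
    rw [smul_smul, mul_neg_one] at this
    exact ⟨a, ha0, this⟩
  · obtain ⟨e⟩ := equivalent_smul_laurentSum_swap ρ ((-1 : F) • ρ) hs hcs
    have := nonempty_isometry_of_laurentSum a₁ a₂ ⟨f.comp e.symm.toIsometry⟩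
    rw [smul_smul, mul_neg_one] at this
    exact ⟨-a, neg_ne_zero.2 ha0, by rwa [neg_neg]⟩

theorem isSupremeTorsionForm_of_laurentSum {Q₁ : QuadraticForm F V} {Q₂ : QuadraticForm F W}
    (h₁ : IsForm Q₁) (h₂ : IsForm Q₂) (h : IsSupremeTorsionForm (laurentSum Q₁ Q₂)) :
    IsSupremeTorsionForm Q₁ ∧ Q₁.Equivalent ((-1 : F) • Q₂) := by
  have := h₁.1
  have := h₂.1
  obtain ⟨a₁, a₂⟩ := anisotropic_of_laurentSum h₁ h₂ h.anisotropic
  obtain ⟨t₁, t₂⟩ := isTorsion_of_laurentSum h₁ h₂ h.torsion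
  refine ⟨⟨h₁, a₁, t₁, fun U _ _ ρ hρ ha ht => ?_⟩, ?_⟩
  · obtain ⟨a, ha0, ⟨f⟩, -⟩ :=
      exists_isometry_of_isSupremeTorsionForm_laurentSum h₁ h₂ h hρ ha ht
    exact ⟨a, ha0, isSubform_of_isometry a₁ (nondegenerate_smul hρ.2 ha0) f⟩
  · obtain ⟨a, ha, ⟨f₁⟩, ⟨f₂⟩⟩ :=
      exists_isometry_of_isSupremeTorsionForm_laurentSum h₁ h₂ h h₁ a₁ t₁
    obtain ⟨b, hb, ⟨g⟩, -⟩ :=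
      exists_isometry_of_isSupremeTorsionForm_laurentSum h₁ h₂ h h₂ a₂ t₂
    have hd := LinearMap.finrank_le_finrank_of_injective (f := g.toLinearMap)
      (injective_of_anisotropic (anisotropic_smul a₂ hb) g)
    have e₁ := equivalent_of_isometry (anisotropic_smul a₁ ha) f₁ le_rfl
    have e₂ := equivalent_of_isometry (anisotropic_smul a₁ (neg_ne_zero.2 ha)) f₂ hd
    refine e₁.symm.trans ?_
    have := equivalent_smul (-1 : F) e₂
    rwa [smul_smul, neg_one_mul, neg_neg] at this

/-- Units of `F[[t]]` differ from their residues by squares, so a form over `F((t))` is recovered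
from its residue forms. -/
theorem HasResidueForms.equivalent_laurentSum {U : Type u} [AddCommGroup U]
    [Module (LaurentSeries F) U] {ψ : QuadraticForm (LaurentSeries F) U} {q₁ : QuadraticForm F V}
    {q₂ : QuadraticForm F W} (h : HasResidueForms ψ q₁ q₂) :
    IsForm q₁ ∧ IsForm q₂ ∧ ψ.Equivalent (laurentSum q₁ q₂) := by
  obtain ⟨r, s, u, v, e, e₁, e₂⟩ := h
  have key {n : ℕ} (u : Fin n → (PowerSeries F)ˣ) :
      (∀ i, PowerSeries.constantCoeff (u i : PowerSeries F) ≠ 0) ∧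
      (diag fun i => HahnSeries.ofPowerSeries ℤ F (u i : PowerSeries F)).Equivalent
        (diag fun i => algebraMap F (LaurentSeries F)
          (PowerSeries.constantCoeff (u i : PowerSeries F))) := by
    have hu i : PowerSeries.constantCoeff (u i : PowerSeries F) ≠ 0 :=
      ((u i).isUnit.map PowerSeries.constantCoeff).ne_zero
    choose c hc h using fun i => exists_ofPowerSeries_eq (hu i)
    exact ⟨hu, ⟨QuadraticForm.isometryEquivWeightedSumSquaresWeightedSumSquares
      (fun i => Units.mk0 (c i) (hc i)) fun i => (h i).symm⟩⟩
  obtain ⟨hu, eu⟩ := key u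
  obtain ⟨hv, ev⟩ := key v
  exact ⟨.of_equivalent e₁ ⟨inferInstance, nondegenerate_weightedSumSquares hu⟩,
    .of_equivalent e₂ ⟨inferInstance, nondegenerate_weightedSumSquares hv⟩,
    e.trans ((eu.prod (equivalent_smul _ ev)).trans
      (equivalent_laurentSum_weightedSumSquares e₁ e₂).symm)⟩

end LaurentSupreme

end QForm

theorem mainTheorem7 {F : Type u} [Field F] [IsSemireal F]
    (hpyth : ∃ a : F, IsSumSq a ∧ ¬ IsSquare a) :
    (∀ (n : ℕ) (V : Type u) [AddCommGroup V] [Module F V] (φ : QuadraticForm F V),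
      QForm.IsPfister n φ → QForm.IsSupremeTorsionForm φ →
        QForm.IsSupremeTorsionForm
          (QForm.tensor (QForm.extend (LaurentSeries F) φ) (QForm.pfister (QForm.t F)))) ∧
    (∀ (V V₁ V₂ : Type u) [AddCommGroup V] [Module (LaurentSeries F) V]
      [AddCommGroup V₁] [Module F V₁] [AddCommGroup V₂] [Module F V₂]
      (ψ : QuadraticForm (LaurentSeries F) V)
      (ψ₁ : QuadraticForm F V₁) (ψ₂ : QuadraticForm F V₂),
      QForm.HasResidueForms ψ ψ₁ (-ψ₂) →
        ψ.Equivalent ((QForm.extend (LaurentSeries F) ψ₁).prod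
          (-QForm.t F • QForm.extend (LaurentSeries F) ψ₂)) ∧
        (QForm.IsSupremeTorsionForm ψ →
          ψ₁.Equivalent ψ₂ ∧ QForm.IsSupremeTorsionForm ψ₁)) := by
  have hsum {U U' : Type u} [AddCommGroup U] [Module F U] [AddCommGroup U'] [Module F U']
      (P : QuadraticForm F U) (Q : QuadraticForm F U') :
      (QForm.extend (LaurentSeries F) P).prod
        (-QForm.t F • QForm.extend (LaurentSeries F) Q) =
          QForm.laurentSum P ((-1 : F) • Q) := by
    rw [QForm.laurentSum, QForm.extend_smul, smul_smul, map_neg, map_one, mul_neg_one]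
  refine ⟨fun n V _ _ φ hp hφ => ?_, fun V V₁ V₂ _ _ _ _ _ _ ψ ψ₁ ψ₂ h => ?_⟩
  · have e := QForm.equivalent_tensor_pfister (QForm.extend (LaurentSeries F) φ) (QForm.t F)
    rw [hsum] at e
    exact (QForm.isSupremeTorsionForm_laurentSum hφ fun a ha =>
      QForm.equivalent_smul_of_isRound hp.isRound hφ ha).of_equivalent e
  · rw [← neg_one_smul F ψ₂] at h
    obtain ⟨h₁, h₂, e⟩ := h.equivalent_laurentSum
    rw [hsum]
    refine ⟨e, fun hψ => ?_⟩
    obtain ⟨hs, e'⟩ := QForm.isSupremeTorsionForm_of_laurentSum h₁ h₂ (hψ.of_equivalent e.symm)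
    rw [smul_smul, neg_one_mul, neg_neg, one_smul] at e'
    exact ⟨e', hs⟩
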